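/- Let $d\ge 1$. For $\varepsilon\in\mathbf R$ let $\mu_\varepsilon$ denote the law on $\mathbf R^{\mathbf Z^d}$ of the centered stationary (translation-invariant) Gaussian field $(X_i)_{i\in\mathbf Z^d}$ such that, for every $i\in\mathbf Z^d$, $$\mu_\varepsilon\big(X_i\in\cdot \mid X_j=\xi_j\ \forall j\ne i\big)=\mathcal N\Big(\frac{\varepsilon}{2d}\sum_{j:\,\|j-i\|_1=1}\xi_j,\ 1\Big)\quad\text{for }\mu_\varepsilon\text{-a.e. }\xi .$$ There is $\varepsilon_0>0$ (depending on $d$) such that for every $\varepsilon$ with $|\varepsilon|<\varepsilon_0$ this law $\mu_\varepsilon$ exists and is unique, and the following hold. 1. $\mu_\varepsilon$ is a factor of an i.i.d. process: there are a probability space $(\mathcal Y,\mathcal F,\nu)$ and a measurable map $F:\mathcal Y^{\mathbf Z^d}\to\mathbf R^{\mathbf Z^d}$ commuting with all translations of $\mathbf Z^d$ such that $\mu_\varepsilon$ is the image of $\nu^{\otimes\mathbf Z^d}$ under $F$. 2. There is $c>0$ such that for every integer $l\ge 0$ there is an $l$-dependent probability measure $\nu_l$ on $\mathbf R^{\mathbf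 Z^d}$ with $$d_{\mathrm{TV}}(\mu_\varepsilon|_\Lambda,\nu_l|_\Lambda)\le|\Lambda|\,e^{-cl}\quad\text{for every finite }\Lambda\subset\mathbf Z^d .$$ Here a measure is $l$-dependent if, for a field $X$ with that law, $X|_A$ and $X|_B$ are independent for all $A,B\subset\mathbf Z^d$ with $\|a-b\|_1>l$ for all $a\in A$, $b\in B$; $\mu|_\Lambda$ is the law of $X|_\Lambda$ when $X$ has law $\mu$; and $d_{\mathrm{TV}}(\mu,\nu)=\sup_A|\mu(A)-\nu(A)|$ over measurable sets $A$. -/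

import Mathlib

open MeasureTheory ProbabilityTheory

namespace GaussFactor

/-- The sites of the lattice `ℤ^d`. -/
abbrev Site (d : ℕ) : Type := Fin d → ℤ

/-- The `ℓ¹` distance on `ℤ^d`. -/
def l1Dist {d : ℕ} (i j : Site d) : ℕ := ∑ k, (i k - j k).natAbs

/-- Translation of configurations by the vector `v`. -/
def shift {d : ℕ} {S : Type*} (v : Site d) (x : Site d → S) : Site d → S :=
  fun i => x (i + v)

/-- The average of the configuration `x` over the `2d` nearest neighbours of the site `i`. -/
noncomputable def neighbourAverage {d : ℕ} (x : Site d → ℝ) (i : Site d) : ℝ :=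
  (∑ k : Fin d, (x (i + Pi.single k 1) + x (i - Pi.single k 1))) / (2 * d)

/-- Translation invariance of a measure on `S^(ℤ^d)`. -/
def IsStationary {d : ℕ} {S : Type*} [MeasurableSpace S] (μ : Measure (Site d → S)) : Prop :=
  ∀ v : Site d, μ.map (shift v) = μ

/-- `μ` is the law of a centered stationary Gaussian field on `ℤ^d` such that for every site `i`
the conditional law of `X_i` given `(X_j)_{j ≠ i}` is the normal law of variance `1` whose mean is
`ε` times the average of the nearest neighbours of `i`. -/
structure IsGaussianMarkovField (d : ℕ) (ε : ℝ) (μ : Measure (Site d → ℝ)) : Prop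
    extends IsProbabilityMeasure μ where
  gaussian : IsGaussianProcess (fun (i : Site d) (x : Site d → ℝ) => x i) μ
  centered : ∀ i : Site d, ∫ x, x i ∂μ = 0
  stationary : IsStationary μ
  conditional : ∀ i : Site d, ∀ᵐ ξ ∂μ,
    condDistrib (fun x : Site d → ℝ => x i)
        (fun (x : Site d → ℝ) (j : {j : Site d // j ≠ i}) => x j) μ (fun j => ξ j)
      = gaussianReal (ε * neighbourAverage ξ i) 1

/-- `μ` is a factor of an i.i.d. process: the image of a product measure `ν^{⊗ ℤ^d}` under a
measurable map that commutes with all translations. -/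
def IsFactorOfIID {d : ℕ} {S : Type*} [MeasurableSpace S] (μ : Measure (Site d → S)) : Prop :=
  ∃ (Y : Type) (_ : MeasurableSpace Y) (ν : Measure Y) (_ : IsProbabilityMeasure ν)
    (F : (Site d → Y) → (Site d → S)),
    Measurable F ∧
    (∀ (v : Site d) (y : Site d → Y), F (shift v y) = shift v (F y)) ∧
    (Measure.infinitePi (fun _ : Site d => ν)).map F = μ

/-- `μ` is `l`-dependent: the restrictions of the field to any two sets of sites at `ℓ¹` distance
greater than `l` are independent. -/
def IsDependent {d : ℕ} {S : Type*} [MeasurableSpace S] (l : ℕ)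
    (μ : Measure (Site d → S)) : Prop :=
  ∀ A B : Set (Site d), (∀ a ∈ A, ∀ b ∈ B, l < l1Dist a b) →
    IndepFun (fun (x : Site d → S) (a : A) => x a) (fun (x : Site d → S) (b : B) => x b) μ

/-- Total variation distance between two probability measures:
the supremum of `|μ A - ν A|` over measurable sets `A`. -/
noncomputable def tvDist {α : Type*} [MeasurableSpace α] (μ ν : Measure α) : ℝ :=
  ⨆ A : {A : Set α // MeasurableSet A}, |μ.real A - ν.real A|

end GaussFactor

/-!
Let `P` be the transition operator of the simple random walk. The conditional laws say that the
residual `X i - ε (P X) i` is a standard normal variable independent of the values off `i`, which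
for a centered Gaussian field means that the covariance `G` satisfies `G = 1 + ε P G`. When
`|ε| < 1` the only bounded solution is `G = ∑ εⁿ Pⁿ`, so `μ_ε` is the Gaussian field with this
covariance.

With `b` the power series of `((1 + ε x) / (2 (1 - ε x))) ^ (1/2)` one has
`G = b(P) ^ 2 + 1/2`. As `P` is symmetric, `μ_ε` is the law of `b(P) ξ + η / √2` for independent
white noises `ξ` and `η`, which exhibits it as a factor of an i.i.d. process. Keeping only the terms
`Pⁿ` of `b(P)` with `n ≤ l / 2` gives an `l`-dependent field. Given `ξ`, the two fields are Gaussian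
with independent coordinates of variance `1/2` and exponentially close means, and a small change of
mean costs little in total variation.
-/

namespace GaussFactor

open Filter Topology
open scoped NNReal

section GaussianProcess

variable {S T Ω Ω' : Type*} {mΩ : MeasurableSpace Ω} {mΩ' : MeasurableSpace Ω'} {P : Measure Ω}
  {Q : Measure Ω'}

theorem integral_sum_mul_sum {X : S → Ω → ℝ} {Y : T → Ω → ℝ} (hX : ∀ s, MemLp (X s) 2 P)
    (hY : ∀ t, MemLp (Y t) 2 P) (I : Finset S) (J : Finset T) (a : S → ℝ) (b : T → ℝ) :
    ∫ ω, (∑ s ∈ I, a s * X s ω) * ∑ t ∈ J, b t * Y t ω ∂P =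
      ∑ s ∈ I, ∑ t ∈ J, a s * b t * ∫ ω, X s ω * Y t ω ∂P := by
  have hint : ∀ s t, Integrable (fun ω => a s * X s ω * (b t * Y t ω)) P := fun s t =>
    ((hX s).const_mul _).integrable_mul ((hY t).const_mul _)
  simp_rw [Finset.sum_mul_sum]
  rw [integral_finsetSum _ fun s _ => integrable_finsetSum _ fun t _ => hint s t]
  refine Finset.sum_congr rfl fun s _ => ?_
  rw [integral_finsetSum _ fun t _ => hint s t]
  refine Finset.sum_congr rfl fun t _ => ?_
  rw [← integral_const_mul]
  exact integral_congr_ae (ae_of_all _ fun ω => mul_mul_mul_comm _ _ _ _)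

theorem map_linearCombination_eq_gaussianReal {X : T → Ω → ℝ} (hX : IsGaussianProcess X P)
    (hX0 : ∀ t, ∫ ω, X t ω ∂P = 0) (I : Finset T) (c : T → ℝ) :
    P.map (fun ω => ∑ t ∈ I, c t * X t ω) =
      gaussianReal 0 (∑ s ∈ I, ∑ t ∈ I, c s * c t * ∫ ω, X s ω * X t ω ∂P).toNNReal := by
  have hgauss : HasGaussianLaw (fun ω => ∑ t ∈ I, c t * X t ω) P :=
    (hX.smul c).hasGaussianLaw_fun_sum
  have hmean : ∫ ω, ∑ t ∈ I, c t * X t ω ∂P = 0 := by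
    rw [integral_finsetSum _ fun t _ => (hX.hasGaussianLaw_eval t).integrable.const_mul _]
    simp [integral_const_mul, hX0]
  rw [hgauss.map_eq_gaussianReal, hmean, variance_of_integral_eq_zero hgauss.aemeasurable hmean]
  have hL2 : ∀ t, MemLp (X t) 2 P := fun t => (hX.hasGaussianLaw_eval t).memLp_two
  simp_rw [sq, integral_sum_mul_sum hL2 hL2]

theorem isGaussianProcess_linearCombination {X : T → Ω → ℝ} (hX : IsGaussianProcess X P)
    (I : S → Finset T) (c : S → T → ℝ) :
    IsGaussianProcess (fun s ω => ∑ t ∈ I s, c s t * X t ω) P := by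
  refine hX.of_isGaussianProcess fun s =>
    ⟨I s, ∑ t : I s, c s t • ContinuousLinearMap.proj t, fun ω => ?_⟩
  simp [← Finset.sum_coe_sort (I s)]

theorem exists_dual_restrict_eq_sum {I : Finset T} (L : (I → ℝ) →L[ℝ] ℝ) :
    ∃ c : T → ℝ, ∀ x : T → ℝ, L (I.restrict x) = ∑ t ∈ I, c t * x t := by
  classical
  refine ⟨fun t => if h : t ∈ I then L (Pi.single ⟨t, h⟩ 1) else 0, fun x => ?_⟩
  have hx : I.restrict x = ∑ t : I, x t • (Pi.single t (1 : ℝ) : I → ℝ) := by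
    ext s
    simp [Finset.sum_apply, Pi.single_apply]
  rw [hx, map_sum, ← Finset.sum_coe_sort I]
  refine Finset.sum_congr rfl fun t _ => ?_
  simp [mul_comm]

theorem map_eq_gaussianReal_of_tendsto [IsProbabilityMeasure P] {U : ℕ → Ω → ℝ} {V : Ω → ℝ}
    {v : ℕ → ℝ≥0} {w : ℝ≥0} (hUm : ∀ n, AEMeasurable (U n) P) (hVm : AEMeasurable V P)
    (hU : ∀ n, P.map (U n) = gaussianReal 0 (v n))
    (hlim : ∀ᵐ ω ∂P, Tendsto (fun n => U n ω) atTop (𝓝 (V ω)))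
    (hv : Tendsto v atTop (𝓝 w)) : P.map V = gaussianReal 0 w := by
  have := Measure.isProbabilityMeasure_map hVm
  have hdist := (tendstoInMeasure_of_tendsto_ae (fun n => (hUm n).aestronglyMeasurable)
    hlim).tendstoInDistribution hUm
  refine Measure.ext_of_charFun (funext fun t => ?_)
  have hV := ProbabilityMeasure.tendsto_iff_tendsto_charFun.1 hdist.tendsto t
  refine tendsto_nhds_unique hV ?_
  simp only [ProbabilityMeasure.coe_mk, hU, charFun_gaussianReal]
  have hcont : Continuous fun x : ℝ≥0 =>
      Complex.exp (t * (0 : ℝ) * Complex.I - x * t ^ 2 / 2) := by fun_prop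
  exact (hcont.tendsto w).comp hv

theorem isGaussianProcess_of_tendsto [IsProbabilityMeasure P] {X : ℕ → T → Ω → ℝ}
    {Y : T → Ω → ℝ} {K : T → T → ℝ} (hX : ∀ n, IsGaussianProcess (X n) P)
    (hX0 : ∀ n t, ∫ ω, X n t ω ∂P = 0) (hY : ∀ t, Measurable (Y t))
    (hlim : ∀ t, ∀ᵐ ω ∂P, Tendsto (fun n => X n t ω) atTop (𝓝 (Y t ω)))
    (hK : ∀ s t, Tendsto (fun n => ∫ ω, X n s ω * X n t ω ∂P) atTop (𝓝 (K s t))) :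
    IsGaussianProcess Y P := by
  refine ⟨fun I => ⟨isGaussian_of_map_eq_gaussianReal fun L => ?_⟩⟩
  obtain ⟨c, hc⟩ := exists_dual_restrict_eq_sum L
  refine ⟨0, (∑ s ∈ I, ∑ t ∈ I, c s * c t * K s t).toNNReal, ?_⟩
  rw [Measure.map_map (by fun_prop) (by fun_prop)]
  simp only [Function.comp_def, hc]
  refine map_eq_gaussianReal_of_tendsto
    (fun n => Finset.aemeasurable_fun_sum _ fun t _ => ((hX n).aemeasurable t).const_mul _)
    (Finset.aemeasurable_fun_sum _ fun t _ => (hY t).aemeasurable.const_mul _)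
    (fun n => map_linearCombination_eq_gaussianReal (hX n) (hX0 n) I c) ?_ ?_
  · filter_upwards [(ae_ball_iff I.countable_toSet).2 fun t _ => hlim t] with ω hω
    exact tendsto_finsetSum _ fun t ht => (hω t ht).const_mul _
  · exact (continuous_real_toNNReal.tendsto _).comp (tendsto_finsetSum _ fun s _ =>
      tendsto_finsetSum _ fun t _ => (hK s t).const_mul _)

theorem isGaussianProcess_comp_measurePreserving {X : T → Ω' → ℝ} (hX : IsGaussianProcess X Q)
    {f : Ω → Ω'} (hf : MeasurePreserving f P Q) :
    IsGaussianProcess (fun t ω => X t (f ω)) P := by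
  refine ⟨fun I => ⟨?_⟩⟩
  have hI : AEMeasurable (fun ω => I.restrict (X · ω)) (P.map f) := by
    rw [hf.map_eq]
    exact (hX.hasGaussianLaw I).aemeasurable
  have hmap := AEMeasurable.map_map_of_aemeasurable hI hf.aemeasurable
  rw [hf.map_eq] at hmap
  exact hmap ▸ (hX.hasGaussianLaw I).isGaussian_map

theorem isGaussianProcess_prod_add [IsProbabilityMeasure P] [IsProbabilityMeasure Q]
    {X : T → Ω → ℝ} {Y : T → Ω' → ℝ} (hX : IsGaussianProcess X P) (hXm : ∀ t, Measurable (X t))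
    (hY : IsGaussianProcess Y Q) (hYm : ∀ t, Measurable (Y t)) :
    IsGaussianProcess (fun t (p : Ω × Ω') => X t p.1 + Y t p.2) (P.prod Q) := by
  refine ⟨fun I => ?_⟩
  have hXI : Measurable fun ω => I.restrict (X · ω) := measurable_pi_lambda _ fun t => hXm t
  have hYI : Measurable fun ω => I.restrict (Y · ω) := measurable_pi_lambda _ fun t => hYm t
  have hfst := (isGaussianProcess_comp_measurePreserving hX
    (measurePreserving_fst (μ := P) (ν := Q))).hasGaussianLaw I
  have hsnd := (isGaussianProcess_comp_measurePreserving hY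
    (measurePreserving_snd (μ := P) (ν := Q))).hasGaussianLaw I
  exact (IndepFun.hasGaussianLaw hfst hsnd (indepFun_prod hXI hYI)).add

theorem isGaussianProcess_map {F : Ω → T → ℝ} (hF : Measurable F)
    (h : IsGaussianProcess (fun t ω => F ω t) P) :
    IsGaussianProcess (fun (t : T) (x : T → ℝ) => x t) (P.map F) := by
  refine ⟨fun I => ⟨?_⟩⟩
  have hI := (h.hasGaussianLaw I).isGaussian_map
  rwa [Measure.map_map (by fun_prop) hF]

theorem integral_map_eval {F : Ω → T → ℝ} (hF : Measurable F) (t : T) :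
    ∫ x, x t ∂(P.map F) = ∫ ω, F ω t ∂P :=
  integral_map hF.aemeasurable (measurable_pi_apply t).aestronglyMeasurable

theorem integral_map_eval_mul_eval {F : Ω → T → ℝ} (hF : Measurable F) (s t : T) :
    ∫ x, x s * x t ∂(P.map F) = ∫ ω, F ω s * F ω t ∂P :=
  integral_map hF.aemeasurable
    ((measurable_pi_apply s).mul (measurable_pi_apply t)).aestronglyMeasurable

theorem eq_of_forall_integral_mul_eq {μ ν : Measure (T → ℝ)}
    (hμ : IsGaussianProcess (fun (t : T) (x : T → ℝ) => x t) μ)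
    (hν : IsGaussianProcess (fun (t : T) (x : T → ℝ) => x t) ν)
    (hμ0 : ∀ t, ∫ x, x t ∂μ = 0) (hν0 : ∀ t, ∫ x, x t ∂ν = 0)
    (h : ∀ s t, ∫ x, x s * x t ∂μ = ∫ x, x s * x t ∂ν) : μ = ν := by
  have := hμ.isProbabilityMeasure
  have := hν.isProbabilityMeasure
  have hproj : IsProjectiveLimit ν fun I : Finset T => μ.map I.restrict := by
    intro I
    refine Measure.ext_of_charFunDual (funext fun L => ?_)
    obtain ⟨c, hc⟩ := exists_dual_restrict_eq_sum L
    have hL : ∀ ρ : Measure (T → ℝ), (ρ.map I.restrict).map L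
        = ρ.map fun x => ∑ t ∈ I, c t * x t := by
      intro ρ
      rw [Measure.map_map (by fun_prop) (by fun_prop)]
      exact congrArg ρ.map (funext hc)
    rw [charFunDual_eq_charFun_map_one, charFunDual_eq_charFun_map_one, hL, hL,
      map_linearCombination_eq_gaussianReal hμ hμ0 I c,
      map_linearCombination_eq_gaussianReal hν hν0 I c]
    simp_rw [h]
  exact IsProjectiveLimit.unique (P := fun I : Finset T => μ.map I.restrict) (fun I => rfl) hproj

end GaussianProcess

section Series

variable {ι Ω : Type*} {mΩ : MeasurableSpace Ω} {P : Measure Ω} {F : ι → Ω → ℝ}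
  {β : ι → ℝ}

theorem tsum_lintegral_enorm_le_ofReal_tsum (hF : ∀ i, Integrable (F i) P)
    (hle : ∀ i, ∫ ω, |F i ω| ∂P ≤ β i) (hβ : Summable β) :
    ∑' i, ∫⁻ ω, ‖F i ω‖ₑ ∂P ≤ ENNReal.ofReal (∑' i, β i) := by
  have hβ0 : ∀ i, 0 ≤ β i := fun i => (integral_nonneg fun ω => abs_nonneg _).trans (hle i)
  rw [ENNReal.ofReal_tsum_of_nonneg hβ0 hβ]
  refine ENNReal.tsum_le_tsum fun i => ?_
  rw [← ofReal_integral_norm_eq_lintegral_enorm (hF i)]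
  exact ENNReal.ofReal_le_ofReal (hle i)

variable [Countable ι]

theorem ae_summable_norm_of_integral_abs_le (hF : ∀ i, Integrable (F i) P)
    (hle : ∀ i, ∫ ω, |F i ω| ∂P ≤ β i) (hβ : Summable β) :
    ∀ᵐ ω ∂P, Summable fun i => ‖F i ω‖ := by
  refine summable_norm_of_tsum_eLpNorm_ne_top le_rfl (fun i => (hF i).aestronglyMeasurable) ?_
  simp_rw [eLpNorm_one_eq_lintegral_enorm]
  exact ne_top_of_le_ne_top ENNReal.ofReal_ne_top (tsum_lintegral_enorm_le_ofReal_tsum hF hle hβ)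

theorem hasSum_integral_of_integral_abs_le (hF : ∀ i, Integrable (F i) P)
    (hle : ∀ i, ∫ ω, |F i ω| ∂P ≤ β i) (hβ : Summable β) :
    HasSum (fun i => ∫ ω, F i ω ∂P) (∫ ω, ∑' i, F i ω ∂P) :=
  hasSum_integral_of_summable_integral_norm hF
    (hβ.of_nonneg_of_le (fun _ => integral_nonneg fun _ => norm_nonneg _) hle)

theorem lintegral_enorm_tsum_le (hF : ∀ i, Integrable (F i) P)
    (hle : ∀ i, ∫ ω, |F i ω| ∂P ≤ β i) (hβ : Summable β) :
    ∫⁻ ω, ‖∑' i, F i ω‖ₑ ∂P ≤ ENNReal.ofReal (∑' i, β i) := by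
  refine le_trans ?_ (tsum_lintegral_enorm_le_ofReal_tsum hF hle hβ)
  rw [← lintegral_tsum fun i => (hF i).aemeasurable.enorm]
  exact lintegral_mono fun ω => enorm_tsum_le_tsum_enorm

theorem integrable_tsum (hF : ∀ i, Measurable (F i)) (hFi : ∀ i, Integrable (F i) P)
    (hle : ∀ i, ∫ ω, |F i ω| ∂P ≤ β i) (hβ : Summable β) :
    Integrable (fun ω => ∑' i, F i ω) P :=
  ⟨(Measurable.tsum hF).aestronglyMeasurable,
    (lintegral_enorm_tsum_le hFi hle hβ).trans_lt ENNReal.ofReal_lt_top⟩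

theorem integral_abs_tsum_le (hF : ∀ i, Measurable (F i)) (hFi : ∀ i, Integrable (F i) P)
    (hle : ∀ i, ∫ ω, |F i ω| ∂P ≤ β i) (hβ : Summable β) :
    ∫ ω, |∑' i, F i ω| ∂P ≤ ∑' i, β i := by
  have hβ0 : ∀ i, 0 ≤ β i := fun i => (integral_nonneg fun ω => abs_nonneg _).trans (hle i)
  rw [← ENNReal.ofReal_le_ofReal_iff (tsum_nonneg hβ0)]
  exact (ofReal_integral_norm_eq_lintegral_enorm (integrable_tsum hF hFi hle hβ)).trans_le
    (lintegral_enorm_tsum_le hFi hle hβ)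

end Series

section GaussianSeries

variable {T Ω : Type*} {mΩ : MeasurableSpace Ω} {P : Measure Ω} {b : ℕ → ℝ}

theorem integral_abs_mul_le_one {f g : Ω → ℝ} (hf : MemLp f 2 P) (hg : MemLp g 2 P)
    (hf1 : ∫ ω, f ω ^ 2 ∂P ≤ 1) (hg1 : ∫ ω, g ω ^ 2 ∂P ≤ 1) : ∫ ω, |f ω * g ω| ∂P ≤ 1 := by
  have hle : ∫ ω, |f ω * g ω| ∂P ≤ ∫ ω, (f ω ^ 2 + g ω ^ 2) / 2 ∂P := by
    refine integral_mono (hf.integrable_mul hg).abs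
      ((hf.integrable_sq.add hg.integrable_sq).div_const 2) fun ω => ?_
    rw [abs_mul]
    nlinarith [sq_nonneg (|f ω| - |g ω|), sq_abs (f ω), sq_abs (g ω)]
  rw [integral_div, integral_add hf.integrable_sq hg.integrable_sq] at hle
  linarith

theorem integral_abs_le_one [IsProbabilityMeasure P] {f : Ω → ℝ} (hf : MemLp f 2 P)
    (hf1 : ∫ ω, f ω ^ 2 ∂P ≤ 1) : ∫ ω, |f ω| ∂P ≤ 1 := by
  simpa using integral_abs_mul_le_one hf (memLp_const 1) hf1 (by simp)

theorem integral_abs_const_mul_le [IsProbabilityMeasure P] {f : Ω → ℝ} (hf : MemLp f 2 P)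
    (hf1 : ∫ ω, f ω ^ 2 ∂P ≤ 1) (c : ℝ) : ∫ ω, |c * f ω| ∂P ≤ |c| := by
  simp_rw [abs_mul, integral_const_mul]
  exact mul_le_of_le_one_right (abs_nonneg c) (integral_abs_le_one hf hf1)

theorem integral_abs_mul_mul_mul_le {f g : Ω → ℝ} (hf : MemLp f 2 P) (hg : MemLp g 2 P)
    (hf1 : ∫ ω, f ω ^ 2 ∂P ≤ 1) (hg1 : ∫ ω, g ω ^ 2 ∂P ≤ 1) (c c' : ℝ) :
    ∫ ω, |c * f ω * (c' * g ω)| ∂P ≤ |c| * |c'| := by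
  simp_rw [mul_mul_mul_comm c, abs_mul (c * c'), integral_const_mul, ← abs_mul c]
  exact mul_le_of_le_one_right (abs_nonneg _) (integral_abs_mul_le_one hf hg hf1 hg1)

theorem hasSum_integral_tsum_mul_tsum [IsProbabilityMeasure P] {Z W : ℕ → Ω → ℝ}
    (hZ : ∀ n, MemLp (Z n) 2 P) (hW : ∀ n, MemLp (W n) 2 P) (hZ1 : ∀ n, ∫ ω, Z n ω ^ 2 ∂P ≤ 1)
    (hW1 : ∀ n, ∫ ω, W n ω ^ 2 ∂P ≤ 1) (hb : Summable fun n => |b n|) :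
    HasSum (fun q : ℕ × ℕ => b q.1 * b q.2 * ∫ ω, Z q.1 ω * W q.2 ω ∂P)
      (∫ ω, (∑' n, b n * Z n ω) * ∑' n, b n * W n ω ∂P) := by
  have hprod : (fun ω => (∑' n, b n * Z n ω) * ∑' n, b n * W n ω)
      =ᵐ[P] fun ω => ∑' q : ℕ × ℕ, b q.1 * Z q.1 ω * (b q.2 * W q.2 ω) := by
    filter_upwards [ae_summable_norm_of_integral_abs_le
        (fun n => ((hZ n).integrable one_le_two).const_mul (b n))
        (fun n => integral_abs_const_mul_le (hZ n) (hZ1 n) (b n)) hb,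
      ae_summable_norm_of_integral_abs_le
        (fun n => ((hW n).integrable one_le_two).const_mul (b n))
        (fun n => integral_abs_const_mul_le (hW n) (hW1 n) (b n)) hb] with ω h1 h2
    exact tsum_mul_tsum_of_summable_norm h1 h2
  have hsum := hasSum_integral_of_integral_abs_le (P := P)
    (F := fun (q : ℕ × ℕ) ω => b q.1 * Z q.1 ω * (b q.2 * W q.2 ω))
    (fun q => ((hZ q.1).const_mul (b q.1)).integrable_mul ((hW q.2).const_mul (b q.2)))
    (fun q => integral_abs_mul_mul_mul_le (hZ q.1) (hW q.2) (hZ1 q.1) (hW1 q.2) (b q.1) (b q.2))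
    (hb.mul_of_nonneg hb (fun n => abs_nonneg _) fun n => abs_nonneg _)
  simp_rw [integral_congr_ae hprod]
  convert hsum using 2 with q
  rw [← integral_const_mul]
  exact integral_congr_ae (ae_of_all _ fun ω => mul_mul_mul_comm _ _ _ _)

theorem tendsto_sum_range_sum_range {E : Type*} [AddCommMonoid E] [TopologicalSpace E]
    {f : ℕ × ℕ → E} {s : E} (hf : HasSum f s) :
    Tendsto (fun N => ∑ n ∈ Finset.range N, ∑ m ∈ Finset.range N, f (n, m)) atTop (𝓝 s) := by
  have hmono : Tendsto (fun N => Finset.range N ×ˢ Finset.range N) atTop atTop :=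
    tendsto_atTop_finset_of_monotone
      (fun _ _ h => Finset.product_subset_product (Finset.range_mono h) (Finset.range_mono h))
      fun q => ⟨max q.1 q.2 + 1, by simp⟩
  simpa only [Function.comp_def, Finset.sum_product] using hf.comp hmono

theorem isGaussianProcess_tsum {Z : ℕ → T → Ω → ℝ}
    (hZ : IsGaussianProcess (fun q : ℕ × T => Z q.1 q.2) P) (hZm : ∀ n t, Measurable (Z n t))
    (hZ0 : ∀ n t, ∫ ω, Z n t ω ∂P = 0) (hZ1 : ∀ n t, ∫ ω, Z n t ω ^ 2 ∂P ≤ 1)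
    (hb : Summable fun n => |b n|) :
    IsGaussianProcess (fun t ω => ∑' n, b n * Z n t ω) P := by
  have := hZ.isProbabilityMeasure
  have hL2 : ∀ n t, MemLp (Z n t) 2 P := fun n t => (hZ.hasGaussianLaw_eval (n, t)).memLp_two
  refine isGaussianProcess_of_tendsto
    (X := fun N t ω => ∑ n ∈ Finset.range N, b n * Z n t ω)
    (K := fun s t => ∫ ω, (∑' n, b n * Z n s ω) * ∑' n, b n * Z n t ω ∂P) (fun N => ?_)
    (fun N t => ?_)
    (fun t => Measurable.tsum fun n => (hZm n t).const_mul _) (fun t => ?_) fun s t => ?_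
  · have := isGaussianProcess_linearCombination hZ
      (fun t => (Finset.range N).map ⟨fun n => (n, t), Prod.mk_left_injective t⟩) fun _ q => b q.1
    simpa only [Finset.sum_map, Function.Embedding.coeFn_mk] using this
  · rw [integral_finsetSum _ fun n _ => ((hL2 n t).integrable one_le_two).const_mul _]
    simp [integral_const_mul, hZ0]
  · filter_upwards [ae_summable_norm_of_integral_abs_le
      (fun n => ((hL2 n t).integrable one_le_two).const_mul (b n))
      (fun n => integral_abs_const_mul_le (hL2 n t) (hZ1 n t) (b n)) hb] with ω hω
    exact hω.of_norm.hasSum.tendsto_sum_nat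
  · refine (tendsto_sum_range_sum_range (hasSum_integral_tsum_mul_tsum (fun n => hL2 n s)
      (fun n => hL2 n t) (fun n => hZ1 n s) (fun n => hZ1 n t) hb)).congr fun N => ?_
    exact (integral_sum_mul_sum (fun n => hL2 n s) (fun n => hL2 n t) _ _ b b).symm

end GaussianSeries

section Lattice

variable {d : ℕ}

theorem l1Dist_self (i : Site d) : l1Dist i i = 0 := by simp [l1Dist]

theorem l1Dist_triangle (i j k : Site d) : l1Dist i k ≤ l1Dist i j + l1Dist j k := by
  unfold l1Dist
  rw [← Finset.sum_add_distrib]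
  exact Finset.sum_le_sum fun m _ => by omega

theorem l1Dist_add_single (i : Site d) (k : Fin d) : l1Dist i (i + Pi.single k 1) = 1 := by
  simp [l1Dist, Pi.single_apply, apply_ite]

theorem l1Dist_sub_single (i : Site d) (k : Fin d) : l1Dist i (i - Pi.single k 1) = 1 := by
  simp [l1Dist, Pi.single_apply, apply_ite]

theorem mem_Icc_of_l1Dist_le {n : ℕ} {i j : Site d} (h : l1Dist i j ≤ n) :
    j ∈ Finset.Icc (i - n) (i + n) := by
  have hk : ∀ k, (i k - j k).natAbs ≤ n := fun k =>
    (Finset.single_le_sum (f := fun k => (i k - j k).natAbs) (fun _ _ => Nat.zero_le _)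
      (Finset.mem_univ k)).trans h
  rw [Finset.mem_Icc, Pi.le_def, Pi.le_def, ← forall_and]
  intro k
  have := hk k
  simp only [Pi.sub_apply, Pi.add_apply, Pi.natCast_apply]
  omega

theorem neighbourAverage_add (x y : Site d → ℝ) :
    neighbourAverage (x + y) = neighbourAverage x + neighbourAverage y := by
  ext i
  simp only [neighbourAverage, Pi.add_apply, ← add_div, ← Finset.sum_add_distrib]
  congr 1
  exact Finset.sum_congr rfl fun k _ => add_add_add_comm _ _ _ _

theorem neighbourAverage_smul (c : ℝ) (x : Site d → ℝ) :
    neighbourAverage (c • x) = c • neighbourAverage x := by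
  ext i
  simp only [neighbourAverage, Pi.smul_apply, smul_eq_mul, ← mul_add, ← Finset.mul_sum,
    mul_div_assoc]

theorem neighbourAverage_shift (v : Site d) (x : Site d → ℝ) :
    neighbourAverage (shift v x) = shift v (neighbourAverage x) := by
  ext i
  simp only [neighbourAverage, shift, add_right_comm, add_sub_right_comm]

theorem neighbourAverage_comp_sub_left (c : Site d) (x : Site d → ℝ) :
    neighbourAverage (fun i => x (c - i)) = fun i => neighbourAverage x (c - i) := by
  ext i
  unfold neighbourAverage
  congr 1
  refine Finset.sum_congr rfl fun k _ => ?_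
  simp only [sub_sub_eq_add_sub, sub_add_eq_sub_sub, add_sub_right_comm]
  exact add_comm _ _

theorem abs_neighbourAverage_le {x : Site d → ℝ} {C : ℝ} (hx : ∀ i, |x i| ≤ C) (i : Site d) :
    |neighbourAverage x i| ≤ C := by
  rw [neighbourAverage, abs_div, abs_of_nonneg (by positivity : (0 : ℝ) ≤ 2 * d)]
  refine div_le_of_le_mul₀ (by positivity) ((abs_nonneg _).trans (hx i)) ?_
  calc |∑ k, (x (i + Pi.single k 1) + x (i - Pi.single k 1))|
      ≤ ∑ _k : Fin d, (C + C) := (Finset.abs_sum_le_sum_abs _ _).trans <|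
        Finset.sum_le_sum fun k _ => (abs_add_le _ _).trans (add_le_add (hx _) (hx _))
    _ = C * (2 * d) := by
      simp only [Finset.sum_const, Finset.card_univ, Fintype.card_fin, nsmul_eq_mul]
      ring

/-- The transition operator of the simple random walk on the lattice. -/
noncomputable def walk (d : ℕ) : Module.End ℝ (Site d → ℝ) where
  toFun := neighbourAverage
  map_add' := neighbourAverage_add
  map_smul' := neighbourAverage_smul

theorem walk_pow_succ_apply (n : ℕ) (x : Site d → ℝ) :
    (walk d ^ (n + 1)) x = neighbourAverage ((walk d ^ n) x) := by
  rw [pow_succ', Module.End.mul_apply]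
  rfl

theorem walk_pow_shift (v : Site d) (x : Site d → ℝ) (n : ℕ) :
    (walk d ^ n) (shift v x) = shift v ((walk d ^ n) x) := by
  induction n with
  | zero => simp
  | succ n ih => rw [walk_pow_succ_apply, walk_pow_succ_apply, ih, neighbourAverage_shift]

theorem walk_pow_comp_sub_left (c : Site d) (x : Site d → ℝ) (n : ℕ) :
    (walk d ^ n) (fun i => x (c - i)) = fun i => (walk d ^ n) x (c - i) := by
  induction n with
  | zero => simp
  | succ n ih => rw [walk_pow_succ_apply, walk_pow_succ_apply, ih, neighbourAverage_comp_sub_left]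

theorem abs_walk_pow_le {x : Site d → ℝ} {C : ℝ} (hx : ∀ i, |x i| ≤ C) (n : ℕ) (i : Site d) :
    |(walk d ^ n) x i| ≤ C := by
  induction n generalizing i with
  | zero => simpa using hx i
  | succ n ih =>
    rw [walk_pow_succ_apply]
    exact abs_neighbourAverage_le ih i

theorem walk_pow_congr {n : ℕ} {i : Site d} {x y : Site d → ℝ}
    (h : ∀ j, l1Dist i j ≤ n → x j = y j) : (walk d ^ n) x i = (walk d ^ n) y i := by
  induction n generalizing i with
  | zero => simpa using h i (l1Dist_self i).le
  | succ n ih =>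
    have hstep : ∀ i', l1Dist i i' = 1 → (walk d ^ n) x i' = (walk d ^ n) y i' := fun i' hi' =>
      ih fun j hj => h j ((l1Dist_triangle i i' j).trans (by omega))
    simp only [walk_pow_succ_apply, neighbourAverage]
    simp_rw [hstep _ (l1Dist_add_single i _), hstep _ (l1Dist_sub_single i _)]

/-- The `n`-step transition probability of the simple random walk from `i` to `j`. -/
noncomputable def walkKernel (n : ℕ) (i j : Site d) : ℝ := (walk d ^ n) (Pi.single j 1) i

theorem walkKernel_zero (i j : Site d) : walkKernel 0 i j = if i = j then 1 else 0 := by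
  simp [walkKernel, Pi.single_apply]

theorem walkKernel_succ (n : ℕ) (i j : Site d) :
    walkKernel (n + 1) i j = neighbourAverage (fun k => walkKernel n k j) i := by
  rw [walkKernel, walk_pow_succ_apply]
  rfl

theorem walkKernel_add (n m : ℕ) (i j : Site d) :
    walkKernel (n + m) i j = (walk d ^ n) (fun k => walkKernel m k j) i := by
  rw [walkKernel, pow_add, Module.End.mul_apply]
  rfl

theorem walkKernel_symm (n : ℕ) (i j : Site d) : walkKernel n i j = walkKernel n j i := by
  have hsingle : (fun k => (Pi.single j 1 : Site d → ℝ) (i + j - k)) = Pi.single i 1 := by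
    ext k
    simp only [Pi.single_apply, sub_eq_iff_eq_add, add_comm i j, add_right_inj, @eq_comm _ i]
  have hreflect := congrFun (walk_pow_comp_sub_left (i + j) (Pi.single j 1) n) j
  rw [hsingle, add_sub_cancel_right] at hreflect
  exact hreflect.symm

theorem abs_walkKernel_le (n : ℕ) (i j : Site d) : |walkKernel n i j| ≤ 1 := by
  refine abs_walk_pow_le (fun k => ?_) n i
  by_cases h : k = j <;> simp [h]

theorem walkKernel_eq_zero {n : ℕ} {i j : Site d} (h : n < l1Dist i j) :
    walkKernel n i j = 0 := by
  refine (walk_pow_congr (y := 0) fun k hk => ?_).trans (by simp)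
  exact Pi.single_eq_of_ne (fun hkj => (hkj ▸ hk).not_gt h) _

theorem walk_pow_apply_eq_sum (n : ℕ) (x : Site d → ℝ) (i : Site d) :
    (walk d ^ n) x i = ∑ j ∈ Finset.Icc (i - n) (i + n), walkKernel n i j * x j := by
  have hx : (walk d ^ n) x i =
      (walk d ^ n) (∑ j ∈ Finset.Icc (i - n) (i + n), x j • Pi.single j 1) i :=
    walk_pow_congr fun j hj => by simp [Pi.single_apply, mem_Icc_of_l1Dist_le hj]
  rw [hx, map_sum, Finset.sum_apply]
  refine Finset.sum_congr rfl fun j _ => ?_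
  rw [map_smul, Pi.smul_apply, smul_eq_mul, mul_comm]
  rfl

/-- The Green function of the simple random walk, each step of which carries the weight `ε`. -/
noncomputable def green (ε : ℝ) (i j : Site d) : ℝ := ∑' n, ε ^ n * walkKernel n i j

variable {ε : ℝ}

theorem norm_green_term_le (ε : ℝ) (i j : Site d) (n : ℕ) :
    ‖ε ^ n * walkKernel n i j‖ ≤ |ε| ^ n := by
  rw [norm_mul, norm_pow, Real.norm_eq_abs, Real.norm_eq_abs]
  exact mul_le_of_le_one_right (by positivity) (abs_walkKernel_le n i j)

theorem summable_green (hε : |ε| < 1) (i j : Site d) :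
    Summable fun n => ε ^ n * walkKernel n i j :=
  .of_norm_bounded (summable_geometric_of_lt_one (abs_nonneg _) hε) (norm_green_term_le ε i j)

theorem abs_green_le (hε : |ε| < 1) (i j : Site d) : |green ε i j| ≤ (1 - |ε|)⁻¹ :=
  tsum_of_norm_bounded (hasSum_geometric_of_lt_one (abs_nonneg _) hε) (norm_green_term_le ε i j)

theorem hasSum_neighbourAverage {f : ℕ → Site d → ℝ} {s : Site d → ℝ}
    (hf : ∀ i, HasSum (fun n => f n i) (s i)) (i : Site d) :
    HasSum (fun n => neighbourAverage (f n) i) (neighbourAverage s i) :=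
  (hasSum_sum fun _ _ => (hf _).add (hf _)).div_const _

theorem green_eq (hε : |ε| < 1) (i j : Site d) :
    green ε i j = (if i = j then 1 else 0) + ε * neighbourAverage (fun k => green ε k j) i := by
  have hsucc : HasSum (fun n => ε ^ (n + 1) * walkKernel (n + 1) i j)
      (ε * neighbourAverage (fun k => green ε k j) i) := by
    refine ((hasSum_neighbourAverage (fun k => (summable_green hε k j).hasSum) i).mul_left
      ε).congr_fun fun n => ?_
    have hsmul := congrFun (neighbourAverage_smul (ε ^ n) fun k => walkKernel n k j) i
    rw [walkKernel_succ, pow_succ', mul_assoc]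
    exact congrArg (ε * ·) hsmul.symm
  rw [green, (summable_green hε i j).tsum_eq_zero_add, hsucc.tsum_eq, walkKernel_zero, pow_zero,
    one_mul]

theorem eq_zero_of_eq_mul_neighbourAverage (hε : |ε| < 1) {f : Site d → ℝ} {C : ℝ}
    (hf : ∀ i, |f i| ≤ C) (hfe : ∀ i, f i = ε * neighbourAverage f i) (i : Site d) : f i = 0 := by
  have hpow : ∀ (n : ℕ) i, |f i| ≤ |ε| ^ n * C := by
    intro n
    induction n with
    | zero => simpa using hf
    | succ n ih =>
      intro i
      rw [hfe, abs_mul, pow_succ', mul_assoc]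
      gcongr
      exact abs_neighbourAverage_le ih i
  have hlim : Tendsto (fun n : ℕ => |ε| ^ n * C) atTop (𝓝 (0 * C)) :=
    (tendsto_pow_atTop_nhds_zero_of_lt_one (abs_nonneg _) hε).mul_const _
  rw [zero_mul] at hlim
  exact abs_nonpos_iff.1 (ge_of_tendsto' hlim fun n => hpow n i)

theorem eq_green_of_resolvent_eq (hε : |ε| < 1) {f : Site d → ℝ} {C : ℝ} {j : Site d}
    (hf : ∀ i, |f i| ≤ C)
    (hfe : ∀ i, f i = (if i = j then 1 else 0) + ε * neighbourAverage f i) (i : Site d) :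
    f i = green ε i j := by
  have hsub : neighbourAverage (fun k => f k - green ε k j) =
      neighbourAverage f - neighbourAverage (fun k => green ε k j) :=
    map_sub (walk d) f fun k => green ε k j
  refine sub_eq_zero.1 (eq_zero_of_eq_mul_neighbourAverage hε (f := fun k => f k - green ε k j)
    (fun k => (abs_sub _ _).trans (add_le_add (hf k) (abs_green_le hε k j))) (fun k => ?_) i)
  rw [hsub, hfe, green_eq hε, Pi.sub_apply]
  ring

end Lattice

section Coefficients

open PowerSeries

theorem abs_choose_le_one {r : ℝ} (h0 : -1 ≤ r) (h1 : r ≤ 1) (n : ℕ) :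
    |Ring.choose r n| ≤ 1 := by
  induction n with
  | zero => simp
  | succ n ih =>
    have h : (n + 1 : ℕ) * Ring.choose r (n + 1) = Ring.choose r n * (r - n) := by
      simpa using Ring.choose_smul_choose r (Nat.le_succ n)
    have hn : (0 : ℝ) < (n + 1 : ℕ) := by positivity
    refine le_of_mul_le_mul_left ?_ hn
    rw [← abs_of_pos hn, ← abs_mul, h, abs_mul, abs_of_pos hn, mul_one]
    refine (mul_le_of_le_one_left (abs_nonneg _) ih).trans ?_
    rw [abs_le]
    push_cast
    constructor <;> linarith

theorem abs_coeff_binomialSeries_le {r : ℝ} (h0 : -1 ≤ r) (h1 : r ≤ 1) (n : ℕ) :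
    |coeff n (PowerSeries.binomialSeries ℝ r : ℝ⟦X⟧)| ≤ 1 := by
  rw [binomialSeries_coeff, smul_eq_mul, mul_one]
  exact abs_choose_le_one h0 h1 n

theorem binomialSeries_half_mul_self :
    (PowerSeries.binomialSeries ℝ (1 / 2 : ℝ) : ℝ⟦X⟧) * PowerSeries.binomialSeries ℝ (1 / 2 : ℝ) =
      1 + X := by
  rw [← binomialSeries_add, add_halves]
  simpa using binomialSeries_nat (R := ℝ) (A := ℝ) 1

theorem binomialSeries_neg_mul_self_mul (r : ℝ) {f : ℝ⟦X⟧}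
    (hf : PowerSeries.binomialSeries ℝ r * PowerSeries.binomialSeries ℝ r = f) :
    PowerSeries.binomialSeries ℝ (-r) * PowerSeries.binomialSeries ℝ (-r) * f = 1 := by
  have hinv : (PowerSeries.binomialSeries ℝ (-r) : ℝ⟦X⟧) * PowerSeries.binomialSeries ℝ r = 1 := by
    rw [← binomialSeries_add, neg_add_cancel, binomialSeries_zero]
  rw [← hf, mul_mul_mul_comm, hinv, one_mul]

theorem rescale_binomialSeries_neg_half_mul_self :
    rescale (-1 : ℝ) (PowerSeries.binomialSeries ℝ (-(1 / 2) : ℝ)) *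
      rescale (-1 : ℝ) (PowerSeries.binomialSeries ℝ (-(1 / 2) : ℝ)) = mk 1 := by
  have h := congrArg (rescale (-1 : ℝ))
    (binomialSeries_neg_mul_self_mul _ binomialSeries_half_mul_self)
  have hX : (1 + C (-1) * X : ℝ⟦X⟧) = 1 - X := by simp [sub_eq_add_neg]
  simp only [map_mul, map_add, map_one, rescale_X, hX] at h
  exact left_inv_eq_right_inv h ((mul_comm _ _).trans (mk_one_mul_one_sub_eq_one ℝ))

/-- The power series of `((1 + x) / (1 - x)) ^ (1 / 2)`. -/
noncomputable def sqrtSeries : ℝ⟦X⟧ :=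
  PowerSeries.binomialSeries ℝ (1 / 2 : ℝ) *
    rescale (-1 : ℝ) (PowerSeries.binomialSeries ℝ (-(1 / 2) : ℝ))

theorem sqrtSeries_mul_self : sqrtSeries * sqrtSeries = (1 + X) * mk 1 := by
  rw [sqrtSeries, mul_mul_mul_comm, binomialSeries_half_mul_self,
    rescale_binomialSeries_neg_half_mul_self]

theorem abs_coeff_sqrtSeries_le (n : ℕ) : |coeff n sqrtSeries| ≤ n + 1 := by
  rw [sqrtSeries, coeff_mul]
  refine (Finset.abs_sum_le_sum_abs _ _).trans ?_
  refine (Finset.sum_le_card_nsmul _ _ 1 fun p _ => ?_).trans (by simp)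
  rw [abs_mul]
  refine mul_le_one₀ (abs_coeff_binomialSeries_le (by norm_num) (by norm_num) _) (abs_nonneg _) ?_
  rw [coeff_rescale, abs_mul, abs_neg_one_pow, one_mul]
  exact abs_coeff_binomialSeries_le (by norm_num) (by norm_num) _

/-- The coefficients of `((1 + ε * x) / (2 * (1 - ε * x))) ^ (1 / 2)`, whose convolution square is
`1 / (1 - ε * x) - 1 / 2`. -/
noncomputable def sqrtCoeff (ε : ℝ) (n : ℕ) : ℝ := (√2)⁻¹ * coeff n sqrtSeries * ε ^ n

theorem sum_antidiagonal_sqrtCoeff (ε : ℝ) (n : ℕ) :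
    ∑ q ∈ Finset.HasAntidiagonal.antidiagonal n, sqrtCoeff ε q.1 * sqrtCoeff ε q.2 =
      if n = 0 then 1 / 2 else ε ^ n := by
  have hsq : (√2)⁻¹ * (√2)⁻¹ = (1 / 2 : ℝ) := by
    rw [← mul_inv, Real.mul_self_sqrt zero_le_two, one_div]
  have hsum : ∑ q ∈ Finset.HasAntidiagonal.antidiagonal n, sqrtCoeff ε q.1 * sqrtCoeff ε q.2 =
      1 / 2 * coeff n ((1 + X) * mk 1 : ℝ⟦X⟧) * ε ^ n := by
    rw [← sqrtSeries_mul_self, coeff_mul, Finset.mul_sum, Finset.sum_mul]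
    refine Finset.sum_congr rfl fun q hq => ?_
    rw [← Finset.HasAntidiagonal.mem_antidiagonal.1 hq, pow_add, ← hsq, sqrtCoeff, sqrtCoeff]
    ring
  rw [hsum, add_mul, one_mul, map_add]
  cases n with
  | zero => simp
  | succ n =>
    rw [coeff_succ_X_mul]
    norm_num

theorem summable_abs_sqrtCoeff_mul_pow {ε R : ℝ} (hR : 0 ≤ R) (h : |ε| * R < 1) :
    Summable fun n => |sqrtCoeff ε n| * R ^ n := by
  have hsum : Summable fun n : ℕ => ((n : ℝ) + 1) * (|ε| * R) ^ n := by
    have hr : ‖|ε| * R‖ < 1 := by rwa [Real.norm_of_nonneg (by positivity)]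
    simpa only [add_mul, one_mul, pow_one] using
      (summable_pow_mul_geometric_of_norm_lt_one 1 hr).add (summable_geometric_of_norm_lt_one hr)
  refine hsum.of_nonneg_of_le (fun n => by positivity) fun n => ?_
  have hcoeff : |(√2)⁻¹ * coeff n sqrtSeries| ≤ n + 1 := by
    rw [abs_mul, abs_of_nonneg (by positivity)]
    exact (mul_le_of_le_one_left (abs_nonneg _)
      (inv_le_one_of_one_le₀ (Real.one_le_sqrt.2 one_le_two))).trans (abs_coeff_sqrtSeries_le n)
  rw [sqrtCoeff, abs_mul, abs_pow, mul_assoc, ← mul_pow]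
  exact mul_le_mul_of_nonneg_right hcoeff (by positivity)

theorem summable_abs_sqrtCoeff {ε : ℝ} (hε : |ε| < 1) : Summable fun n => |sqrtCoeff ε n| := by
  simpa using summable_abs_sqrtCoeff_mul_pow zero_le_one (by rwa [mul_one])

end Coefficients

section WhiteNoise

variable {T : Type*}

/-- The law of a family of independent standard Gaussian variables: Gaussian white noise, which
drives the moving averages below. -/
noncomputable def whiteNoise (T : Type*) : Measure (T → ℝ) :=
  Measure.infinitePi fun _ => gaussianReal 0 1

instance : IsProbabilityMeasure (whiteNoise T) :=
  inferInstanceAs (IsProbabilityMeasure (Measure.infinitePi fun _ => gaussianReal 0 1))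

theorem map_eval_whiteNoise (t : T) : (whiteNoise T).map (fun x => x t) = gaussianReal 0 1 :=
  Measure.infinitePi_map_eval _ t

theorem iIndepFun_whiteNoise : iIndepFun (fun (t : T) (x : T → ℝ) => x t) (whiteNoise T) :=
  iIndepFun_infinitePi (X := fun _ x => x) fun _ => measurable_id

theorem isGaussianProcess_whiteNoise :
    IsGaussianProcess (fun (t : T) (x : T → ℝ) => x t) (whiteNoise T) := by
  refine ⟨fun I => ?_⟩
  have hindep : iIndepFun (fun (t : I) (x : T → ℝ) => x t) (whiteNoise T) :=
    iIndepFun_whiteNoise.precomp Subtype.val_injective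
  exact hindep.hasGaussianLaw fun t => ⟨(map_eval_whiteNoise _).symm ▸ inferInstance⟩

theorem integral_whiteNoise (t : T) : ∫ x, x t ∂(whiteNoise T) = 0 := by
  have h := integral_map (μ := whiteNoise T) (measurable_pi_apply t).aemeasurable
    (f := fun x : ℝ => x) (by fun_prop)
  rw [← h, map_eval_whiteNoise, integral_id_gaussianReal]

theorem memLp_whiteNoise (t : T) : MemLp (fun x : T → ℝ => x t) 2 (whiteNoise T) :=
  (isGaussianProcess_whiteNoise.hasGaussianLaw_eval t).memLp_two

theorem integral_mul_whiteNoise [DecidableEq T] (s t : T) :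
    ∫ x, x s * x t ∂(whiteNoise T) = if s = t then 1 else 0 := by
  split_ifs with h
  · subst h
    have hvar := variance_of_integral_eq_zero (measurable_pi_apply s).aemeasurable
      (integral_whiteNoise s)
    have hone : Var[fun x : T → ℝ => x s; whiteNoise T] = 1 := by
      rw [← variance_id_map (measurable_pi_apply s).aemeasurable, map_eval_whiteNoise,
        variance_id_gaussianReal, NNReal.coe_one]
    rw [← hone, hvar]
    simp_rw [sq]
  · rw [(iIndepFun_whiteNoise.indepFun h).integral_fun_mul_eq_mul_integral
      (measurable_pi_apply s).aestronglyMeasurable (measurable_pi_apply t).aestronglyMeasurable,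
      integral_whiteNoise, zero_mul]

theorem map_swap_infinitePi_infinitePi {κ S : Type*} {mS : MeasurableSpace S} (μ : Measure S)
    [IsProbabilityMeasure μ] :
    (Measure.infinitePi fun _ : T => Measure.infinitePi fun _ : κ => μ).map Function.swap =
      Measure.infinitePi fun _ : κ => Measure.infinitePi fun _ : T => μ := by
  rw [← Measure.infinitePi_map_curry fun (_ : T) (_ : κ) => μ,
    ← Measure.infinitePi_map_curry fun (_ : κ) (_ : T) => μ,
    ← Measure.map_infinitePi_infinitePi_of_inj (P := fun _ : T × κ => μ)
      (Prod.swap_injective (α := κ) (β := T)),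
    Measure.map_map (by fun_prop) (by fun_prop), Measure.map_map (by fun_prop) (by fun_prop)]
  rfl

theorem map_eval_eval_infinitePi_whiteNoise {κ : Type*} {s t : κ} (hst : s ≠ t) :
    (Measure.infinitePi fun _ : T => whiteNoise κ).map (fun y => (fun i => y i s, fun i => y i t)) =
      (whiteNoise T).prod (whiteNoise T) := by
  rw [← Measure.infinitePi_map_eval_prod (P := fun _ : κ => whiteNoise T) hst, whiteNoise,
    whiteNoise, ← map_swap_infinitePi_infinitePi,
    Measure.map_map (by fun_prop) (by fun_prop)]
  rfl

end WhiteNoise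

section WalkNoise

variable {d : ℕ}

theorem measurable_walk_pow (n : ℕ) (i : Site d) :
    Measurable fun ξ : Site d → ℝ => (walk d ^ n) ξ i := by
  simp_rw [walk_pow_apply_eq_sum]
  fun_prop

theorem isGaussianProcess_walk_pow :
    IsGaussianProcess (fun (q : ℕ × Site d) ξ => (walk d ^ q.1) ξ q.2) (whiteNoise (Site d)) := by
  simp_rw [walk_pow_apply_eq_sum]
  exact isGaussianProcess_linearCombination isGaussianProcess_whiteNoise
    (fun q : ℕ × Site d => Finset.Icc (q.2 - q.1) (q.2 + q.1)) fun q => walkKernel q.1 q.2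

theorem memLp_walk_pow (n : ℕ) (i : Site d) :
    MemLp (fun ξ => (walk d ^ n) ξ i) 2 (whiteNoise (Site d)) :=
  (isGaussianProcess_walk_pow.hasGaussianLaw_eval (n, i)).memLp_two

theorem integral_walk_pow (n : ℕ) (i : Site d) :
    ∫ ξ, (walk d ^ n) ξ i ∂(whiteNoise (Site d)) = 0 := by
  simp_rw [walk_pow_apply_eq_sum]
  rw [integral_finsetSum _ fun j _ => ((memLp_whiteNoise j).integrable one_le_two).const_mul _]
  simp [integral_const_mul, integral_whiteNoise]

theorem integral_walk_pow_mul_walk_pow (n m : ℕ) (i j : Site d) :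
    ∫ ξ, (walk d ^ n) ξ i * (walk d ^ m) ξ j ∂(whiteNoise (Site d)) = walkKernel (n + m) i j := by
  calc ∫ ξ, (walk d ^ n) ξ i * (walk d ^ m) ξ j ∂(whiteNoise (Site d))
      = ∑ k ∈ Finset.Icc (i - n) (i + n), walkKernel n i k *
          ∑ r ∈ Finset.Icc (j - m) (j + m), walkKernel m j r * (Pi.single k 1 : Site d → ℝ) r := by
        simp_rw [walk_pow_apply_eq_sum, integral_sum_mul_sum memLp_whiteNoise memLp_whiteNoise,
          Finset.mul_sum, integral_mul_whiteNoise, mul_assoc, Pi.single_apply, eq_comm]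
    _ = ∑ k ∈ Finset.Icc (i - n) (i + n), walkKernel n i k * walkKernel m k j := by
        simp_rw [← walk_pow_apply_eq_sum m, walkKernel_symm m _ j]
        rfl
    _ = walkKernel (n + m) i j := by rw [walkKernel_add, walk_pow_apply_eq_sum]

theorem integral_walk_pow_sq_le (n : ℕ) (i : Site d) :
    ∫ ξ, (walk d ^ n) ξ i ^ 2 ∂(whiteNoise (Site d)) ≤ 1 := by
  simp_rw [sq, integral_walk_pow_mul_walk_pow]
  exact (le_abs_self _).trans (abs_walkKernel_le _ i i)

end WalkNoise

section MovingAverage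

variable {d : ℕ} {b b' : ℕ → ℝ}

/-- The moving average `∑ b n Pⁿ ξ`, with `P` the random walk operator; it is the part of the
Gaussian fields below that is correlated over distinct sites. -/
noncomputable def movingAverage (b : ℕ → ℝ) (ξ : Site d → ℝ) (i : Site d) : ℝ :=
  ∑' n, b n * (walk d ^ n) ξ i

theorem measurable_movingAverage :
    Measurable (movingAverage b : (Site d → ℝ) → Site d → ℝ) :=
  measurable_pi_lambda _ fun i => Measurable.tsum fun n => (measurable_walk_pow n i).const_mul _

theorem movingAverage_shift (v : Site d) (ξ : Site d → ℝ) :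
    movingAverage b (shift v ξ) = shift v (movingAverage b ξ) := by
  ext i
  simp only [movingAverage, walk_pow_shift]
  rfl

theorem isGaussianProcess_movingAverage (hb : Summable fun n => |b n|) :
    IsGaussianProcess (fun (i : Site d) ξ => movingAverage b ξ i) (whiteNoise (Site d)) :=
  isGaussianProcess_tsum isGaussianProcess_walk_pow measurable_walk_pow integral_walk_pow
    integral_walk_pow_sq_le hb

theorem integral_movingAverage (hb : Summable fun n => |b n|) (i : Site d) :
    ∫ ξ, movingAverage b ξ i ∂(whiteNoise (Site d)) = 0 := by
  have hsum := hasSum_integral_of_integral_abs_le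
    (fun n => ((memLp_walk_pow n i).integrable one_le_two).const_mul (b n))
    (fun n => integral_abs_const_mul_le (memLp_walk_pow n i) (integral_walk_pow_sq_le n i) (b n)) hb
  simp_rw [integral_const_mul, integral_walk_pow, mul_zero] at hsum
  exact hsum.unique hasSum_zero

theorem hasSum_integral_movingAverage_mul (hb : Summable fun n => |b n|) (i j : Site d) :
    HasSum (fun q : ℕ × ℕ => b q.1 * b q.2 * walkKernel (q.1 + q.2) i j)
      (∫ ξ, movingAverage b ξ i * movingAverage b ξ j ∂(whiteNoise (Site d))) := by
  simpa only [integral_walk_pow_mul_walk_pow] using!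
    hasSum_integral_tsum_mul_tsum (fun n => memLp_walk_pow n i) (fun n => memLp_walk_pow n j)
      (fun n => integral_walk_pow_sq_le n i) (fun n => integral_walk_pow_sq_le n j) hb

theorem integral_movingAverage_mul_eq_zero (hb : Summable fun n => |b n|) {N : ℕ}
    (hN : ∀ n, N < n → b n = 0) {i j : Site d} (hij : 2 * N < l1Dist i j) :
    ∫ ξ, movingAverage b ξ i * movingAverage b ξ j ∂(whiteNoise (Site d)) = 0 := by
  have hterm : ∀ q : ℕ × ℕ, b q.1 * b q.2 * walkKernel (q.1 + q.2) i j = 0 := by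
    intro q
    by_cases hq : q.1 ≤ N ∧ q.2 ≤ N
    · rw [walkKernel_eq_zero (by omega), mul_zero]
    · rcases not_and_or.1 hq with h | h <;> simp [hN _ (not_le.1 h)]
  have hsum := hasSum_integral_movingAverage_mul hb i j
  simp_rw [hterm] at hsum
  exact hsum.unique hasSum_zero

theorem ae_movingAverage_sub (hb : Summable fun n => |b n|) (hb' : Summable fun n => |b' n|)
    (i : Site d) : ∀ᵐ ξ ∂(whiteNoise (Site d)),
      movingAverage b ξ i - movingAverage b' ξ i = movingAverage (b - b') ξ i := by
  have hsum : ∀ {c : ℕ → ℝ}, (Summable fun n => |c n|) →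
      ∀ᵐ ξ ∂(whiteNoise (Site d)), Summable fun n => c n * (walk d ^ n) ξ i := fun hc =>
    (ae_summable_norm_of_integral_abs_le
      (fun n => ((memLp_walk_pow n i).integrable one_le_two).const_mul _)
      (fun n => integral_abs_const_mul_le (memLp_walk_pow n i) (integral_walk_pow_sq_le n i) _)
      hc).mono fun ξ hξ => hξ.of_norm
  filter_upwards [hsum hb, hsum hb'] with ξ hξ hξ'
  simp only [movingAverage, Pi.sub_apply, sub_mul]
  exact (hξ.tsum_sub hξ').symm

theorem integrable_movingAverage (hb : Summable fun n => |b n|) (i : Site d) :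
    Integrable (fun ξ => movingAverage b ξ i) (whiteNoise (Site d)) :=
  ((isGaussianProcess_movingAverage hb).hasGaussianLaw_eval i).integrable

theorem integral_abs_movingAverage_le (hb : Summable fun n => |b n|) (i : Site d) :
    ∫ ξ, |movingAverage b ξ i| ∂(whiteNoise (Site d)) ≤ ∑' n, |b n| :=
  integral_abs_tsum_le (fun n => (measurable_walk_pow n i).const_mul _)
    (fun n => ((memLp_walk_pow n i).integrable one_le_two).const_mul _)
    (fun n => integral_abs_const_mul_le (memLp_walk_pow n i) (integral_walk_pow_sq_le n i) _) hb

theorem integral_abs_movingAverage_sub_le (hb : Summable fun n => |b n|)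
    (hb' : Summable fun n => |b' n|) (i : Site d) :
    ∫ ξ, |movingAverage b ξ i - movingAverage b' ξ i| ∂(whiteNoise (Site d)) ≤
      ∑' n, |b n - b' n| := by
  have hsub : Summable fun n => |(b - b') n| := (hb.of_abs.sub hb'.of_abs).abs
  refine le_trans (integral_congr_ae ?_).le (integral_abs_movingAverage_le hsub i)
  filter_upwards [ae_movingAverage_sub hb hb' i] with ξ hξ
  rw [hξ]

end MovingAverage

section SmoothedField

variable {d : ℕ} {b : ℕ → ℝ} {ε : ℝ}

theorem integral_prod_add_mul_add {Ω Ω' : Type*} {mΩ : MeasurableSpace Ω}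
    {mΩ' : MeasurableSpace Ω'} {P : Measure Ω} {Q : Measure Ω'} [IsProbabilityMeasure P]
    [IsProbabilityMeasure Q] {X Y : Ω → ℝ} {X' Y' : Ω' → ℝ} (hX : MemLp X 2 P) (hY : MemLp Y 2 P)
    (hX' : MemLp X' 2 Q) (hY' : MemLp Y' 2 Q) (hX0 : ∫ ω, X ω ∂P = 0) (hY0 : ∫ ω, Y ω ∂P = 0) :
    ∫ p, (X p.1 + X' p.2) * (Y p.1 + Y' p.2) ∂(P.prod Q) =
      ∫ ω, X ω * Y ω ∂P + ∫ ω, X' ω * Y' ω ∂Q := by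
  have hfst : ∀ {f g : Ω → ℝ}, MemLp f 2 P → MemLp g 2 P →
      Integrable (fun p : Ω × Ω' => f p.1 * g p.1) (P.prod Q) := fun hf hg =>
    (hf.integrable_mul hg).comp_fst Q
  have hsnd : Integrable (fun p : Ω × Ω' => X' p.2 * Y' p.2) (P.prod Q) :=
    (hX'.integrable_mul hY').comp_snd P
  have hcross : ∀ {f : Ω → ℝ} {g : Ω' → ℝ}, MemLp f 2 P → MemLp g 2 Q →
      Integrable (fun p : Ω × Ω' => f p.1 * g p.2) (P.prod Q) := fun hf hg =>
    (hf.integrable one_le_two).mul_prod (hg.integrable one_le_two)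
  calc ∫ p, (X p.1 + X' p.2) * (Y p.1 + Y' p.2) ∂(P.prod Q)
      = ∫ p, (X p.1 * Y p.1 + X' p.2 * Y' p.2) + (X p.1 * Y' p.2 + Y p.1 * X' p.2) ∂(P.prod Q) :=
        integral_congr_ae (ae_of_all _ fun p => by ring)
    _ = ∫ p, X p.1 * Y p.1 ∂(P.prod Q) + ∫ p, X' p.2 * Y' p.2 ∂(P.prod Q) +
          (∫ p, X p.1 * Y' p.2 ∂(P.prod Q) + ∫ p, Y p.1 * X' p.2 ∂(P.prod Q)) :=
        (integral_add ((hfst hX hY).add hsnd) ((hcross hX hY').add (hcross hY hX'))).trans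
          (congrArg₂ (· + ·) (integral_add (hfst hX hY) hsnd)
            (integral_add (hcross hX hY') (hcross hY hX')))
    _ = ∫ ω, X ω * Y ω ∂P + ∫ ω, X' ω * Y' ω ∂Q := by
        rw [integral_prod_mul X Y', integral_prod_mul Y X', hX0, hY0, zero_mul, zero_mul,
          integral_fun_fst fun ω => X ω * Y ω, integral_fun_snd fun ω => X' ω * Y' ω]
        simp

/-- The field `η / √2 + ∑ b n Pⁿ ξ` obtained from two noises `p = (ξ, η)`. The second noise has
the same law at every site given `ξ`, which makes the law of the field depend continuously, in
total variation, on the coefficients `b`. -/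
noncomputable def smoothedField (b : ℕ → ℝ) (p : (Site d → ℝ) × (Site d → ℝ)) (i : Site d) : ℝ :=
  movingAverage b p.1 i + (√2)⁻¹ * p.2 i

theorem measurable_smoothedField :
    Measurable (smoothedField b : (Site d → ℝ) × (Site d → ℝ) → Site d → ℝ) := by
  refine measurable_pi_lambda _ fun i => ?_
  exact ((measurable_pi_apply i).comp (measurable_movingAverage.comp measurable_fst)).add
    (((measurable_pi_apply i).comp measurable_snd).const_mul _)

/-- The law of the smoothed field when both noises are white. -/
noncomputable def smoothedLaw (d : ℕ) (b : ℕ → ℝ) : Measure (Site d → ℝ) :=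
  ((whiteNoise (Site d)).prod (whiteNoise (Site d))).map (smoothedField b)

instance : IsProbabilityMeasure (smoothedLaw d b) :=
  Measure.isProbabilityMeasure_map measurable_smoothedField.aemeasurable

theorem isGaussianProcess_smoothedLaw (hb : Summable fun n => |b n|) :
    IsGaussianProcess (fun (i : Site d) (x : Site d → ℝ) => x i) (smoothedLaw d b) :=
  isGaussianProcess_map measurable_smoothedField <|
    isGaussianProcess_prod_add (isGaussianProcess_movingAverage hb)
      (fun i => (measurable_pi_apply i).comp measurable_movingAverage)
      (isGaussianProcess_whiteNoise.smul fun _ => (√2)⁻¹)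
      fun i => (measurable_pi_apply i).const_mul _

theorem integral_smoothedLaw (hb : Summable fun n => |b n|) (i : Site d) :
    ∫ x, x i ∂(smoothedLaw d b) = 0 := by
  rw [smoothedLaw, integral_map_eval measurable_smoothedField]
  simp_rw [smoothedField]
  rw [integral_add ((integrable_movingAverage hb i).comp_fst _)
      ((((memLp_whiteNoise i).integrable one_le_two).const_mul _).comp_snd _),
    integral_fun_fst fun ξ : Site d → ℝ => movingAverage b ξ i,
    integral_fun_snd fun η : Site d → ℝ => (√2)⁻¹ * η i, integral_movingAverage hb,
    integral_const_mul, integral_whiteNoise]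
  simp

theorem integral_smoothedLaw_mul (hb : Summable fun n => |b n|) (i j : Site d) :
    ∫ x, x i * x j ∂(smoothedLaw d b) =
      ∫ ξ, movingAverage b ξ i * movingAverage b ξ j ∂(whiteNoise (Site d)) +
        if i = j then 1 / 2 else 0 := by
  have hL2 : ∀ k, MemLp (fun ξ : Site d → ℝ => movingAverage b ξ k) 2 (whiteNoise (Site d)) :=
    fun k => ((isGaussianProcess_movingAverage hb).hasGaussianLaw_eval k).memLp_two
  have hη : ∫ η : Site d → ℝ, (√2)⁻¹ * η i * ((√2)⁻¹ * η j) ∂(whiteNoise (Site d)) =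
      if i = j then 1 / 2 else 0 := by
    simp_rw [mul_mul_mul_comm (√2)⁻¹ (_ : ℝ) (√2)⁻¹, integral_const_mul, integral_mul_whiteNoise]
    rw [← mul_inv, Real.mul_self_sqrt zero_le_two, mul_ite, mul_one, mul_zero, one_div]
  rw [smoothedLaw, integral_map_eval_mul_eval measurable_smoothedField, ← hη]
  exact integral_prod_add_mul_add (hL2 i) (hL2 j) ((memLp_whiteNoise i).const_mul _)
    ((memLp_whiteNoise j).const_mul _) (integral_movingAverage hb i) (integral_movingAverage hb j)

theorem integral_smoothedLaw_sqrtCoeff_mul (hε : |ε| < 1) (i j : Site d) :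
    ∫ x, x i * x j ∂(smoothedLaw d (sqrtCoeff ε)) = green ε i j := by
  have hterm : ∀ n, ∑ q : Finset.HasAntidiagonal.antidiagonal n,
      sqrtCoeff ε q.1.1 * sqrtCoeff ε q.1.2 * walkKernel (q.1.1 + q.1.2) i j =
        ε ^ n * walkKernel n i j - if n = 0 then (if i = j then 1 / 2 else 0) else 0 := by
    intro n
    have hcongr : ∀ q : Finset.HasAntidiagonal.antidiagonal n,
        sqrtCoeff ε q.1.1 * sqrtCoeff ε q.1.2 * walkKernel (q.1.1 + q.1.2) i j =
          sqrtCoeff ε q.1.1 * sqrtCoeff ε q.1.2 * walkKernel n i j := fun q => by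
      rw [Finset.HasAntidiagonal.mem_antidiagonal.1 q.2]
    rw [Finset.sum_congr rfl fun q _ => hcongr q, ← Finset.sum_mul,
      Finset.sum_coe_sort (Finset.HasAntidiagonal.antidiagonal n)
        fun q => sqrtCoeff ε q.1 * sqrtCoeff ε q.2, sum_antidiagonal_sqrtCoeff]
    rcases eq_or_ne n 0 with rfl | hn
    · rw [walkKernel_zero]
      split_ifs <;> norm_num
    · simp only [if_neg hn, sub_zero]
  have hsum := hasSum_integral_movingAverage_mul (summable_abs_sqrtCoeff hε) i j
  rw [← Finset.HasAntidiagonal.sigmaAntidiagonalEquivProd.hasSum_iff] at hsum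
  have hanti := hsum.sigma fun n => hasSum_fintype _
  simp only [Function.comp_apply, Finset.HasAntidiagonal.sigmaAntidiagonalEquivProd_apply,
    hterm] at hanti
  have hgreen := (summable_green hε i j).hasSum.sub
    (hasSum_ite_eq 0 (if i = j then (1 / 2 : ℝ) else 0))
  rw [integral_smoothedLaw_mul (summable_abs_sqrtCoeff hε), hanti.unique hgreen, green,
    sub_add_cancel]

theorem isDependent_of_integral_mul_eq_zero {μ : Measure (Site d → ℝ)} {l : ℕ}
    (hμ : IsGaussianProcess (fun (i : Site d) (x : Site d → ℝ) => x i) μ)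
    (hμ0 : ∀ i, ∫ x, x i ∂μ = 0) (h : ∀ i j, l < l1Dist i j → ∫ x, x i * x j ∂μ = 0) :
    IsDependent l μ := by
  intro A B hAB
  have hjoint : IsGaussianProcess (Sum.elim (fun (a : A) (x : Site d → ℝ) => x a)
      fun (a : B) (x : Site d → ℝ) => x a) μ := by
    convert! hμ.comp_right (Sum.elim (Subtype.val : A → Site d) (Subtype.val : B → Site d))
      using 1
    ext (a | a) <;> rfl
  have := hμ.isProbabilityMeasure
  refine hjoint.indepFun_of_covariance_eq_zero (fun a => hμ.aemeasurable a)
    (fun a => hμ.aemeasurable a) fun a a' => ?_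
  rw [covariance_eq_sub (hμ.hasGaussianLaw_eval a).memLp_two (hμ.hasGaussianLaw_eval a').memLp_two,
    hμ0, zero_mul, sub_zero]
  exact h a a' (hAB a a.2 a' a'.2)

theorem isDependent_smoothedLaw (hb : Summable fun n => |b n|) {N : ℕ}
    (hN : ∀ n, N < n → b n = 0) : IsDependent (2 * N) (smoothedLaw d b) := by
  refine isDependent_of_integral_mul_eq_zero (isGaussianProcess_smoothedLaw hb)
    (integral_smoothedLaw hb) fun i j hij => ?_
  have hne : i ≠ j := by
    rintro rfl
    simp [l1Dist_self] at hij
  rw [integral_smoothedLaw_mul hb, integral_movingAverage_mul_eq_zero hb hN hij, if_neg hne,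
    add_zero]

theorem isFactorOfIID_smoothedLaw : IsFactorOfIID (smoothedLaw d b) := by
  refine ⟨Bool → ℝ, inferInstance, whiteNoise Bool, inferInstance,
    fun y => smoothedField b (fun i => y i true, fun i => y i false),
    measurable_smoothedField.comp (by fun_prop), fun v y => ?_, ?_⟩
  · ext i
    exact congrArg (· + (√2)⁻¹ * y (i + v) false)
      (congrFun (movingAverage_shift v fun j => y j true) i)
  · rw [smoothedLaw, ← map_eval_eval_infinitePi_whiteNoise (Bool.noConfusion : true ≠ false),
      Measure.map_map measurable_smoothedField (by fun_prop)]
    rfl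

theorem measurable_shift {S : Type*} [MeasurableSpace S] (v : Site d) :
    Measurable (shift v : (Site d → S) → Site d → S) :=
  measurable_pi_lambda _ fun _ => measurable_pi_apply _

theorem IsFactorOfIID.isStationary {S : Type*} [MeasurableSpace S] {μ : Measure (Site d → S)}
    (h : IsFactorOfIID μ) : IsStationary μ := by
  obtain ⟨Y, _, ν, _, F, hF, hcomm, rfl⟩ := h
  intro v
  have hcomp : shift v ∘ F = F ∘ shift v := funext fun y => (hcomm v y).symm
  rw [Measure.map_map (measurable_shift v) hF, hcomp, ← Measure.map_map hF (measurable_shift v)]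
  exact congrArg (Measure.map F) (Measure.map_infinitePi_infinitePi_of_inj (add_left_injective v))

end SmoothedField

section ConditionalLaw

variable {Ω β : Type*} {mΩ : MeasurableSpace Ω} {mβ : MeasurableSpace β} {P : Measure Ω}

theorem condDistrib_comp_ae_eq_iff_map_eq_compProd {S : Type*} [MeasurableSpace S]
    [StandardBorelSpace S] [Nonempty S] [IsFiniteMeasure P] {X : Ω → β} {Y : Ω → S}
    (hX : Measurable X) (hY : Measurable Y) {κ : Kernel β S} [IsFiniteKernel κ] :
    (∀ᵐ ω ∂P, condDistrib Y X P (X ω) = κ (X ω)) ↔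
      P.map (fun ω => (X ω, Y ω)) = P.map X ⊗ₘ κ := by
  refine ⟨fun h => ?_, fun h => ae_of_ae_map hX.aemeasurable
    (condDistrib_ae_eq_of_measure_eq_compProd X hY.aemeasurable h)⟩
  rw [← compProd_map_condDistrib (X := X) hY.aemeasurable]
  ext s hs
  rw [Measure.compProd_apply hs, Measure.compProd_apply hs,
    lintegral_map (Kernel.measurable_kernel_prodMk_left hs) hX,
    lintegral_map (Kernel.measurable_kernel_prodMk_left hs) hX]
  exact lintegral_congr_ae (h.mono fun ω hω =>
    congrArg (fun ρ : Measure S => ρ (Prod.mk (X ω) ⁻¹' s)) hω)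

theorem compProd_gaussianReal {ρ : Measure β} [SFinite ρ] {m : β → ℝ} (hm : Measurable m)
    {v : ℝ≥0} {κ : Kernel β ℝ} [IsSFiniteKernel κ] (hκ : ∀ y, κ y = gaussianReal (m y) v) :
    ρ ⊗ₘ κ = (ρ.prod (gaussianReal 0 v)).map fun p => (p.1, p.2 + m p.1) := by
  ext s hs
  have hshift : Measurable fun p : β × ℝ => (p.1, p.2 + m p.1) := by fun_prop
  rw [Measure.compProd_apply hs, Measure.map_apply hshift hs, Measure.prod_apply (hshift hs)]
  refine lintegral_congr fun y => ?_
  have hy : gaussianReal (m y) v = (gaussianReal 0 v).map (· + m y) := by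
    rw [gaussianReal_map_add_const, zero_add]
  rw [hκ, hy, Measure.map_apply (by fun_prop) (measurable_prodMk_left hs)]
  rfl

theorem condDistrib_ae_eq_gaussianReal_iff [IsProbabilityMeasure P] {X : Ω → β} {Y : Ω → ℝ}
    {m : β → ℝ} (hX : Measurable X) (hY : Measurable Y) (hm : Measurable m) {v : ℝ≥0} :
    (∀ᵐ ω ∂P, condDistrib Y X P (X ω) = gaussianReal (m (X ω)) v) ↔
      IndepFun X (fun ω => Y ω - m (X ω)) P ∧
        P.map (fun ω => Y ω - m (X ω)) = gaussianReal 0 v := by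
  let κ : Kernel β ℝ := ⟨fun y => gaussianReal (m y) v,
    measurable_gaussianReal.comp (hm.prodMk measurable_const)⟩
  have hκ : ∀ y, κ y = gaussianReal (m y) v := fun _ => rfl
  have : IsMarkovKernel κ := ⟨fun y => by rw [hκ]; infer_instance⟩
  have := Measure.isProbabilityMeasure_map (μ := P) hX.aemeasurable
  have hZ : Measurable fun ω => Y ω - m (X ω) := hY.sub (hm.comp hX)
  let e : β × ℝ ≃ᵐ β × ℝ :=
    { toFun p := (p.1, p.2 + m p.1)
      invFun p := (p.1, p.2 - m p.1)
      left_inv p := by simp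
      right_inv p := by simp
      measurable_toFun := by dsimp; fun_prop
      measurable_invFun := by dsimp; fun_prop }
  have hpair : P.map (fun ω => (X ω, Y ω)) = (P.map fun ω => (X ω, Y ω - m (X ω))).map e := by
    rw [Measure.map_map e.measurable (hX.prodMk hZ)]
    exact congrArg P.map (funext fun ω => by simp [e])
  calc (∀ᵐ ω ∂P, condDistrib Y X P (X ω) = κ (X ω))
      ↔ P.map (fun ω => (X ω, Y ω)) = P.map X ⊗ₘ κ :=
        condDistrib_comp_ae_eq_iff_map_eq_compProd hX hY
    _ ↔ P.map (fun ω => (X ω, Y ω - m (X ω))) = (P.map X).prod (gaussianReal 0 v) := by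
        rw [hpair, compProd_gaussianReal hm hκ]
        exact e.map_measurableEquiv_injective.eq_iff
    _ ↔ _ := by
        rw [indepFun_iff_map_prod_eq_prod_map_map hX.aemeasurable hZ.aemeasurable]
        refine ⟨fun h => ?_, fun h => by rw [h.1, h.2]⟩
        have hlaw : P.map (fun ω => Y ω - m (X ω)) = gaussianReal 0 v := by
          simpa [Measure.snd_map_prodMk hX] using congrArg Measure.snd h
        exact ⟨by rw [h, hlaw], hlaw⟩

end ConditionalLaw

section Markov

variable {d : ℕ} {ε : ℝ} {μ : Measure (Site d → ℝ)}

/-- The value of the field at `i` minus its prediction by the neighbours. -/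
noncomputable def residual (ε : ℝ) (i : Site d) (x : Site d → ℝ) : ℝ :=
  x i - ε * neighbourAverage x i

theorem residual_eq_sum (i : Site d) (x : Site d → ℝ) :
    residual ε i x = ∑ j ∈ Finset.Icc (i - 1) (i + 1),
      ((if i = j then 1 else 0) - ε * walkKernel 1 i j) * x j := by
  have hx : neighbourAverage x i = ∑ j ∈ Finset.Icc (i - 1) (i + 1), walkKernel 1 i j * x j := by
    simpa only [walk_pow_succ_apply, pow_zero, Module.End.one_apply, Nat.cast_one] using
      walk_pow_apply_eq_sum 1 x i
  have hi : i ∈ Finset.Icc (i - 1) (i + 1) := by simp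
  simp [residual, hx, sub_mul, Finset.sum_sub_distrib, Finset.mul_sum, mul_assoc, ite_mul, hi]

theorem integral_residual_mul {g : (Site d → ℝ) → ℝ} (hg : ∀ k, Integrable (fun x => x k * g x) μ)
    (i : Site d) : ∫ x, residual ε i x * g x ∂μ = residual ε i fun k => ∫ x, x k * g x ∂μ := by
  simp_rw [residual_eq_sum, Finset.sum_mul, mul_assoc]
  rw [integral_finsetSum _ fun k _ => (hg k).const_mul _]
  simp_rw [integral_const_mul]

theorem isGaussianProcess_residual
    (hμ : IsGaussianProcess (fun (i : Site d) (x : Site d → ℝ) => x i) μ) :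
    IsGaussianProcess (Sum.elim (fun (j : Site d) (x : Site d → ℝ) => x j) (residual ε)) μ := by
  convert! isGaussianProcess_linearCombination hμ
    (Sum.elim (fun j => {j}) fun i => Finset.Icc (i - 1) (i + 1))
    (Sum.elim (fun _ _ => 1) fun i j => (if i = j then 1 else 0) - ε * walkKernel 1 i j) using 1
  ext (j | i) x
  · simp
  · exact residual_eq_sum i x

theorem memLp_residual (hμ : IsGaussianProcess (fun (i : Site d) (x : Site d → ℝ) => x i) μ)
    (i : Site d) : MemLp (residual ε i) 2 μ :=
  ((isGaussianProcess_residual hμ).hasGaussianLaw_eval (.inr i)).memLp_two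

theorem integral_residual (hμ : IsGaussianProcess (fun (i : Site d) (x : Site d → ℝ) => x i) μ)
    (hμ0 : ∀ i, ∫ x, x i ∂μ = 0) (i : Site d) : ∫ x, residual ε i x ∂μ = 0 := by
  simp_rw [residual_eq_sum]
  rw [integral_finsetSum _ fun k _ => (hμ.hasGaussianLaw_eval k).integrable.const_mul _]
  simp [integral_const_mul, hμ0]

theorem add_single_ne (i : Site d) (k : Fin d) : i + Pi.single k 1 ≠ i := by
  rw [ne_eq, add_eq_left, Pi.single_eq_zero_iff]
  exact one_ne_zero

theorem sub_single_ne (i : Site d) (k : Fin d) : i - Pi.single k 1 ≠ i := by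
  rw [ne_eq, sub_eq_self, Pi.single_eq_zero_iff]
  exact one_ne_zero

theorem residual_eq_self {i : Site d} {x : Site d → ℝ} (hx : ∀ j, j ≠ i → x j = 0) :
    residual ε i x = x i := by
  simp [residual, neighbourAverage, hx _ (add_single_ne i _), hx _ (sub_single_ne i _)]

theorem integral_residual_mul_residual
    (hμ : IsGaussianProcess (fun (i : Site d) (x : Site d → ℝ) => x i) μ) {i : Site d}
    (h : ∀ j, j ≠ i → ∫ x, residual ε i x * x j ∂μ = 0) :
    ∫ x, residual ε i x * residual ε i x ∂μ = ∫ x, residual ε i x * x i ∂μ := by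
  rw [integral_residual_mul fun k =>
    (hμ.hasGaussianLaw_eval k).memLp_two.integrable_mul (memLp_residual hμ i)]
  simp_rw [mul_comm _ (residual ε i _)]
  exact residual_eq_self h

theorem map_residual_eq_gaussianReal_iff
    (hμ : IsGaussianProcess (fun (i : Site d) (x : Site d → ℝ) => x i) μ)
    (hμ0 : ∀ i, ∫ x, x i ∂μ = 0) (i : Site d) :
    μ.map (residual ε i) = gaussianReal 0 1 ↔ ∫ x, residual ε i x * residual ε i x ∂μ = 1 := by
  have hlaw := map_linearCombination_eq_gaussianReal
    ((isGaussianProcess_residual hμ).comp_right Sum.inr) (integral_residual (ε := ε) hμ hμ0) {i} 1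
  simp only [Finset.sum_singleton, Pi.one_apply, one_mul, Function.comp_apply,
    Sum.elim_inr] at hlaw
  rw [hlaw, gaussianReal_ext_iff, Real.toNNReal_eq_one]
  exact and_iff_right rfl

theorem indepFun_residual_iff
    (hμ : IsGaussianProcess (fun (i : Site d) (x : Site d → ℝ) => x i) μ)
    (hμ0 : ∀ i, ∫ x, x i ∂μ = 0) (i : Site d) :
    IndepFun (fun (x : Site d → ℝ) (j : {j : Site d // j ≠ i}) => x j) (residual ε i) μ ↔
      ∀ j, j ≠ i → ∫ x, residual ε i x * x j ∂μ = 0 := by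
  have := hμ.isProbabilityMeasure
  refine ⟨fun h j hj => ?_, fun h => ?_⟩
  · have hij : IndepFun (residual ε i) (fun x => x j) μ :=
      h.symm.comp measurable_id (measurable_pi_apply (⟨j, hj⟩ : {j : Site d // j ≠ i}))
    rw [hij.integral_fun_mul_eq_mul_integral (memLp_residual hμ i).1
      (measurable_pi_apply j).aestronglyMeasurable, integral_residual hμ hμ0, zero_mul]
  · have hjoint : IsGaussianProcess (Sum.elim
        (fun (j : {j : Site d // j ≠ i}) (x : Site d → ℝ) => x j)
        fun (_ : Unit) => residual ε i) μ := by
      convert! (isGaussianProcess_residual hμ).comp_right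
        (Sum.map Subtype.val fun _ : Unit => i) using 1
      ext (j | j) <;> rfl
    refine (hjoint.indepFun_of_covariance_eq_zero (fun j => hμ.aemeasurable j)
      (fun _ => (memLp_residual hμ i).1.aemeasurable) fun j _ => ?_).comp measurable_id
        (measurable_pi_apply ())
    rw [covariance_comm, covariance_eq_sub (memLp_residual hμ i)
      (hμ.hasGaussianLaw_eval j).memLp_two, integral_residual hμ hμ0, zero_mul, sub_zero]
    exact h j j.2

/-- The prediction of the value at `i` by the neighbours, as a function of the values at the sites
different from `i`. -/
noncomputable def prediction (ε : ℝ) (i : Site d) (y : {j : Site d // j ≠ i} → ℝ) : ℝ :=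
  ε * ((∑ k : Fin d, (y ⟨_, add_single_ne i k⟩ + y ⟨_, sub_single_ne i k⟩)) / (2 * d))

theorem measurable_prediction (i : Site d) : Measurable (prediction ε i) := by
  unfold prediction
  fun_prop

theorem conditional_iff_integral_mul_eq [IsProbabilityMeasure μ]
    (hμ : IsGaussianProcess (fun (i : Site d) (x : Site d → ℝ) => x i) μ)
    (hμ0 : ∀ i, ∫ x, x i ∂μ = 0) (i : Site d) :
    (∀ᵐ ξ ∂μ, condDistrib (fun x : Site d → ℝ => x i)
        (fun (x : Site d → ℝ) (j : {j : Site d // j ≠ i}) => x j) μ (fun j => ξ j) =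
          gaussianReal (ε * neighbourAverage ξ i) 1) ↔
      ∀ j, ∫ x, x i * x j ∂μ =
        (if i = j then 1 else 0) + ε * neighbourAverage (fun k => ∫ x, x k * x j ∂μ) i := by
  have hresidual : ∀ j, ∫ x, residual ε i x * x j ∂μ =
      ∫ x, x i * x j ∂μ - ε * neighbourAverage (fun k => ∫ x, x k * x j ∂μ) i := fun j =>
    integral_residual_mul (fun k => (hμ.hasGaussianLaw_eval k).memLp_two.integrable_mul
      (hμ.hasGaussianLaw_eval j).memLp_two) i
  calc _ ↔ IndepFun (fun (x : Site d → ℝ) (j : {j : Site d // j ≠ i}) => x j) (residual ε i) μ ∧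
        μ.map (residual ε i) = gaussianReal 0 1 :=
        condDistrib_ae_eq_gaussianReal_iff (by fun_prop) (measurable_pi_apply i)
          (measurable_prediction i)
    _ ↔ (∀ j, j ≠ i → ∫ x, residual ε i x * x j ∂μ = 0) ∧ ∫ x, residual ε i x * x i ∂μ = 1 := by
        rw [indepFun_residual_iff hμ hμ0, map_residual_eq_gaussianReal_iff hμ hμ0]
        exact and_congr_right fun h => by rw [integral_residual_mul_residual hμ h]
    _ ↔ ∀ j, ∫ x, residual ε i x * x j ∂μ = if i = j then 1 else 0 := by
        refine ⟨fun h j => ?_, fun h => ⟨fun j hj => ?_, ?_⟩⟩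
        · split_ifs with hij
          exacts [hij ▸ h.2, h.1 j (Ne.symm hij)]
        · rw [h, if_neg hj.symm]
        · rw [h, if_pos rfl]
    _ ↔ _ := forall_congr' fun j => by rw [hresidual, sub_eq_iff_eq_add]

theorem abs_integral_mul_le_of_isStationary (hμ : IsStationary μ)
    (hL : ∀ i, MemLp (fun x : Site d → ℝ => x i) 2 μ) (i j : Site d) :
    |∫ x, x i * x j ∂μ| ≤ ∫ x, x 0 ^ 2 ∂μ := by
  have hsq : ∀ i, ∫ x, x i ^ 2 ∂μ = ∫ x, x 0 ^ 2 ∂μ := fun i => by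
    conv_rhs => rw [← hμ i]
    rw [integral_map (measurable_shift i).aemeasurable
      ((measurable_pi_apply 0).pow_const 2).aestronglyMeasurable]
    simp [shift]
  have hint : ∀ i, Integrable (fun x : Site d → ℝ => x i ^ 2) μ := fun i => (hL i).integrable_sq
  calc |∫ x, x i * x j ∂μ| ≤ ∫ x, |x i * x j| ∂μ := abs_integral_le_integral_abs
    _ ≤ ∫ x, (x i ^ 2 + x j ^ 2) / 2 ∂μ := by
        refine integral_mono ((hL i).integrable_mul (hL j)).abs
          (((hint i).add (hint j)).div_const 2) fun x => abs_le.2 ⟨?_, ?_⟩ <;>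
        nlinarith [sq_nonneg (x i - x j), sq_nonneg (x i + x j)]
    _ = ∫ x, x 0 ^ 2 ∂μ := by
        rw [integral_div, integral_add (hint i) (hint j), hsq i, hsq j, add_self_div_two]

theorem IsGaussianMarkovField.integral_mul_eq_green (hε : |ε| < 1)
    (hμ : IsGaussianMarkovField d ε μ) (i j : Site d) : ∫ x, x i * x j ∂μ = green ε i j :=
  have := hμ.toIsProbabilityMeasure
  eq_green_of_resolvent_eq hε
    (fun i => abs_integral_mul_le_of_isStationary hμ.stationary
      (fun k => (hμ.gaussian.hasGaussianLaw_eval k).memLp_two) i j)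
    (fun i => (conditional_iff_integral_mul_eq hμ.gaussian hμ.centered i).1
      (hμ.conditional i) j) i

theorem isGaussianMarkovField_smoothedLaw (hε : |ε| < 1) :
    IsGaussianMarkovField d ε (smoothedLaw d (sqrtCoeff ε)) where
  gaussian := isGaussianProcess_smoothedLaw (summable_abs_sqrtCoeff hε)
  centered := integral_smoothedLaw (summable_abs_sqrtCoeff hε)
  stationary := isFactorOfIID_smoothedLaw.isStationary
  conditional i := by
    refine (conditional_iff_integral_mul_eq
      (isGaussianProcess_smoothedLaw (summable_abs_sqrtCoeff hε))
      (integral_smoothedLaw (summable_abs_sqrtCoeff hε)) i).2 fun j => ?_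
    simp_rw [integral_smoothedLaw_sqrtCoeff_mul hε]
    exact green_eq hε i j

theorem IsGaussianMarkovField.eq_smoothedLaw (hε : |ε| < 1) (hμ : IsGaussianMarkovField d ε μ) :
    μ = smoothedLaw d (sqrtCoeff ε) := by
  refine eq_of_forall_integral_mul_eq hμ.gaussian
    (isGaussianProcess_smoothedLaw (summable_abs_sqrtCoeff hε)) hμ.centered
    (integral_smoothedLaw (summable_abs_sqrtCoeff hε)) fun i j => ?_
  rw [hμ.integral_mul_eq_green hε, integral_smoothedLaw_sqrtCoeff_mul hε]

end Markov

section TotalVariation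

variable {α β γ : Type*} [MeasurableSpace α] [MeasurableSpace β] [MeasurableSpace γ]

theorem tvDist_le {μ ν : Measure α} {c : ℝ}
    (h : ∀ A, MeasurableSet A → |μ.real A - ν.real A| ≤ c) : tvDist μ ν ≤ c :=
  have : Nonempty {A : Set α // MeasurableSet A} := ⟨∅, .empty⟩
  ciSup_le fun A => h A A.2

theorem tvDist_comm (μ ν : Measure α) : tvDist μ ν = tvDist ν μ := by
  simp only [tvDist, abs_sub_comm]

theorem tvDist_self (μ : Measure α) : tvDist μ μ = 0 := by simp [tvDist]

theorem abs_measureReal_sub_le_tvDist {μ ν : Measure α} [IsFiniteMeasure μ] [IsFiniteMeasure ν]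
    {A : Set α} (hA : MeasurableSet A) : |μ.real A - ν.real A| ≤ tvDist μ ν := by
  refine le_ciSup (f := fun A : {A : Set α // MeasurableSet A} => |μ.real A - ν.real A|)
    ⟨μ.real Set.univ + ν.real Set.univ, ?_⟩ ⟨A, hA⟩
  rintro _ ⟨B, rfl⟩
  have hμ := measureReal_mono (μ := μ) (Set.subset_univ B.1)
  have hν := measureReal_mono (μ := ν) (Set.subset_univ B.1)
  refine (abs_sub _ _).trans ?_
  rw [abs_of_nonneg measureReal_nonneg, abs_of_nonneg measureReal_nonneg]
  exact add_le_add hμ hν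

theorem tvDist_triangle (μ ν ρ : Measure α) [IsFiniteMeasure μ] [IsFiniteMeasure ν]
    [IsFiniteMeasure ρ] : tvDist μ ρ ≤ tvDist μ ν + tvDist ν ρ :=
  tvDist_le fun _ hA => (abs_sub_le _ _ _).trans
    (add_le_add (abs_measureReal_sub_le_tvDist hA) (abs_measureReal_sub_le_tvDist hA))

theorem tvDist_map_le (μ ν : Measure α) [IsFiniteMeasure μ] [IsFiniteMeasure ν] {f : α → β}
    (hf : Measurable f) : tvDist (μ.map f) (ν.map f) ≤ tvDist μ ν :=
  tvDist_le fun A hA => by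
    rw [map_measureReal_apply hf hA, map_measureReal_apply hf hA]
    exact abs_measureReal_sub_le_tvDist (hf hA)

theorem tvDist_le_of_measureReal_sub_le {μ ν : Measure α} [IsProbabilityMeasure μ]
    [IsProbabilityMeasure ν] {c : ℝ} (h : ∀ A, MeasurableSet A → μ.real A - ν.real A ≤ c) :
    tvDist μ ν ≤ c := by
  refine tvDist_le fun A hA => abs_le.2 ⟨?_, h A hA⟩
  have hcompl := h Aᶜ hA.compl
  rw [probReal_compl_eq_one_sub hA, probReal_compl_eq_one_sub hA] at hcompl
  linarith

theorem tvDist_le_one (μ ν : Measure α) [IsProbabilityMeasure μ] [IsProbabilityMeasure ν] :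
    tvDist μ ν ≤ 1 :=
  tvDist_le_of_measureReal_sub_le fun _ _ =>
    (sub_le_self _ measureReal_nonneg).trans measureReal_le_one

theorem integrable_measureReal_map_prodMk {μ : Measure α} {ν : Measure β} [IsProbabilityMeasure μ]
    [IsProbabilityMeasure ν] {g : α × β → γ} (hg : Measurable g) {A : Set γ}
    (hA : MeasurableSet A) : Integrable (fun x => (ν.map fun y => g (x, y)).real A) μ := by
  have happly : ∀ x, (ν.map fun y => g (x, y)).real A = ν.real (Prod.mk x ⁻¹' (g ⁻¹' A)) :=
    fun x => map_measureReal_apply (hg.comp measurable_prodMk_left) hA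
  simp_rw [happly]
  refine .of_bound (measurable_measure_prodMk_left (hg hA)).ennreal_toReal.aestronglyMeasurable 1
    (ae_of_all _ fun x => ?_)
  rw [Real.norm_of_nonneg measureReal_nonneg]
  exact measureReal_le_one

theorem measureReal_map_prod {μ : Measure α} {ν : Measure β} [IsFiniteMeasure ν] {g : α × β → γ}
    (hg : Measurable g) {A : Set γ} (hA : MeasurableSet A) :
    ((μ.prod ν).map g).real A = ∫ x, (ν.map fun y => g (x, y)).real A ∂μ := by
  have happly : ∀ x, (ν.map fun y => g (x, y)).real A = ν.real (Prod.mk x ⁻¹' (g ⁻¹' A)) :=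
    fun x => map_measureReal_apply (hg.comp measurable_prodMk_left) hA
  simp_rw [happly, Measure.real]
  rw [Measure.map_apply hg hA, Measure.prod_apply (hg hA),
    integral_toReal (measurable_measure_prodMk_left (hg hA)).aemeasurable
      (ae_of_all _ fun x => measure_lt_top _ _)]

theorem tvDist_map_prod_le {μ : Measure α} {ν ν' : Measure β} [IsProbabilityMeasure μ]
    [IsProbabilityMeasure ν] [IsProbabilityMeasure ν'] {g h : α × β → γ} (hg : Measurable g)
    (hh : Measurable h) {f : α → ℝ} (hf : Integrable f μ)
    (hle : ∀ x, tvDist (ν.map fun y => g (x, y)) (ν'.map fun y => h (x, y)) ≤ f x) :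
    tvDist ((μ.prod ν).map g) ((μ.prod ν').map h) ≤ ∫ x, f x ∂μ := by
  refine tvDist_le fun A hA => ?_
  rw [measureReal_map_prod hg hA, measureReal_map_prod hh hA,
    ← integral_sub (integrable_measureReal_map_prodMk hg hA)
      (integrable_measureReal_map_prodMk hh hA)]
  rw [← Real.norm_eq_abs]
  refine norm_integral_le_of_norm_le hf (ae_of_all _ fun x => ?_)
  exact (abs_measureReal_sub_le_tvDist hA).trans (hle x)

theorem tvDist_prod_right_le (μ : Measure α) (ν ν' : Measure β) [IsProbabilityMeasure μ]
    [IsProbabilityMeasure ν] [IsProbabilityMeasure ν'] :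
    tvDist (μ.prod ν) (μ.prod ν') ≤ tvDist ν ν' := by
  simpa using tvDist_map_prod_le measurable_id measurable_id (integrable_const (μ := μ) _)
    fun x => tvDist_map_le ν ν' measurable_prodMk_left

theorem tvDist_prod_le (μ μ' : Measure α) (ν ν' : Measure β) [IsProbabilityMeasure μ]
    [IsProbabilityMeasure μ'] [IsProbabilityMeasure ν] [IsProbabilityMeasure ν'] :
    tvDist (μ.prod ν) (μ'.prod ν') ≤ tvDist μ μ' + tvDist ν ν' := by
  have hleft : tvDist (μ.prod ν) (μ'.prod ν) ≤ tvDist μ μ' := by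
    have hswap := tvDist_map_le (ν.prod μ) (ν.prod μ') measurable_swap
    rw [Measure.prod_swap, Measure.prod_swap] at hswap
    exact hswap.trans (tvDist_prod_right_le ν μ μ')
  exact (tvDist_triangle _ (μ'.prod ν) _).trans
    (add_le_add hleft (tvDist_prod_right_le μ' ν ν'))

theorem tvDist_pi_fin_le {n : ℕ} {X : Fin n → Type*} [∀ i, MeasurableSpace (X i)]
    (μ ν : ∀ i, Measure (X i)) [∀ i, IsProbabilityMeasure (μ i)]
    [∀ i, IsProbabilityMeasure (ν i)] :
    tvDist (Measure.pi μ) (Measure.pi ν) ≤ ∑ i, tvDist (μ i) (ν i) := by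
  induction n with
  | zero =>
    rw [Measure.pi_of_empty μ, Measure.pi_of_empty ν, tvDist_self]
    simp
  | succ n ih =>
    rw [← (measurePreserving_piFinSuccAbove μ 0).symm.map_eq,
      ← (measurePreserving_piFinSuccAbove ν 0).symm.map_eq, Fin.sum_univ_succ]
    exact (tvDist_map_le _ _ (MeasurableEquiv.measurable _)).trans
      ((tvDist_prod_le _ _ _ _).trans (add_le_add_right (ih _ _) _))

theorem tvDist_pi_le {ι : Type*} [Fintype ι] {X : ι → Type*} [∀ i, MeasurableSpace (X i)]
    (μ ν : ∀ i, Measure (X i)) [∀ i, IsProbabilityMeasure (μ i)]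
    [∀ i, IsProbabilityMeasure (ν i)] :
    tvDist (Measure.pi μ) (Measure.pi ν) ≤ ∑ i, tvDist (μ i) (ν i) := by
  let e := (Fintype.equivFin ι).symm
  rw [← (measurePreserving_piCongrLeft μ e).map_eq, ← (measurePreserving_piCongrLeft ν e).map_eq,
    ← e.sum_comp]
  exact (tvDist_map_le _ _ (MeasurableEquiv.measurable _)).trans (tvDist_pi_fin_le _ _)

end TotalVariation

section GaussianTotalVariation

variable {v : ℝ≥0}

theorem measureReal_gaussianReal (hv : v ≠ 0) (z : ℝ) (A : Set ℝ) :
    (gaussianReal z v).real A = ∫ x in A, gaussianPDFReal z v x := by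
  rw [Measure.real, gaussianReal_apply_eq_integral z hv, ENNReal.toReal_ofReal]
  exact integral_nonneg fun x => gaussianPDFReal_nonneg _ _ _

theorem gaussianPDFReal_le (z : ℝ) (v : ℝ≥0) (x : ℝ) :
    gaussianPDFReal z v x ≤ (√(2 * Real.pi * v))⁻¹ := by
  refine mul_le_of_le_one_right (by positivity) (Real.exp_le_one_iff.2 ?_)
  rw [neg_div]
  exact neg_nonpos.2 (by positivity)

theorem gaussianPDFReal_le_gaussianPDFReal_iff (hv : v ≠ 0) {z w : ℝ} (hzw : z < w) (x : ℝ) :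
    gaussianPDFReal w v x ≤ gaussianPDFReal z v x ↔ x ≤ (z + w) / 2 := by
  have : (0 : ℝ) < v := by positivity
  rw [gaussianPDFReal, gaussianPDFReal, mul_le_mul_iff_right₀ (by positivity), Real.exp_le_exp,
    div_le_div_iff_of_pos_right (by positivity), neg_le_neg_iff]
  constructor <;> intro h <;> nlinarith

theorem measureReal_gaussianReal_Iic_sub_le (hv : v ≠ 0) {z w : ℝ} (hzw : z ≤ w) (a : ℝ) :
    (gaussianReal z v).real (Set.Iic a) - (gaussianReal w v).real (Set.Iic a) ≤
      (w - z) * (√(2 * Real.pi * v))⁻¹ := by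
  have hshift : (gaussianReal w v).real (Set.Iic a) =
      (gaussianReal z v).real (Set.Iic (a - (w - z))) := by
    rw [← add_sub_cancel z w, ← gaussianReal_map_add_const (μ := z) (v := v) (w - z),
      map_measureReal_apply (by fun_prop) measurableSet_Iic, add_sub_cancel,
      Set.preimage_add_const_Iic]
  have hdiff : Set.Iic a \ Set.Iic (a - (w - z)) = Set.Ioc (a - (w - z)) a := by
    ext x
    simp [and_comm]
  rw [hshift, ← measureReal_sdiff (Set.Iic_subset_Iic.2 (by linarith)) measurableSet_Iic, hdiff,
    measureReal_gaussianReal hv]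
  calc ∫ x in Set.Ioc (a - (w - z)) a, gaussianPDFReal z v x
      ≤ ∫ _ in Set.Ioc (a - (w - z)) a, (√(2 * Real.pi * v))⁻¹ :=
        integral_mono (integrable_gaussianPDFReal z v).integrableOn (integrable_const _)
          (gaussianPDFReal_le z v)
    _ = (w - z) * (√(2 * Real.pi * v))⁻¹ := by
        rw [setIntegral_const, smul_eq_mul, Real.volume_real_Ioc_of_le (by linarith),
          sub_sub_cancel]

theorem measureReal_gaussianReal_sub_le (hv : v ≠ 0) {z w : ℝ} (hzw : z < w) {A : Set ℝ}
    (hA : MeasurableSet A) :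
    (gaussianReal z v).real A - (gaussianReal w v).real A ≤ (w - z) * (√(2 * Real.pi * v))⁻¹ := by
  have hint := fun z => integrable_gaussianPDFReal z v
  have hsub : ∀ B, (gaussianReal z v).real B - (gaussianReal w v).real B =
      ∫ x in B, (gaussianPDFReal z v - gaussianPDFReal w v) x := fun B => by
    rw [measureReal_gaussianReal hv, measureReal_gaussianReal hv]
    exact (integral_sub (hint z).integrableOn (hint w).integrableOn).symm
  have hset : {x | 0 ≤ (gaussianPDFReal z v - gaussianPDFReal w v) x} = Set.Iic ((z + w) / 2) := by
    ext x
    rw [Set.mem_ofPred_eq, Pi.sub_apply, sub_nonneg,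
      gaussianPDFReal_le_gaussianPDFReal_iff hv hzw, Set.mem_Iic]
  calc (gaussianReal z v).real A - (gaussianReal w v).real A
      ≤ (gaussianReal z v).real (Set.Iic ((z + w) / 2)) -
          (gaussianReal w v).real (Set.Iic ((z + w) / 2)) := by
        rw [hsub, hsub, ← hset]
        exact setIntegral_le_nonneg hA ((stronglyMeasurable_gaussianPDFReal z v).sub
          (stronglyMeasurable_gaussianPDFReal w v)) ((hint z).sub (hint w))
    _ ≤ _ := measureReal_gaussianReal_Iic_sub_le hv hzw.le _

theorem tvDist_gaussianReal_le (hv : v ≠ 0) (z w : ℝ) :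
    tvDist (gaussianReal z v) (gaussianReal w v) ≤ |z - w| * (√(2 * Real.pi * v))⁻¹ := by
  wlog hzw : z ≤ w generalizing z w
  · rw [tvDist_comm, abs_sub_comm]
    exact this w z (le_of_not_ge hzw)
  rcases hzw.eq_or_lt with rfl | hlt
  · simp [tvDist_self]
  · rw [abs_sub_comm, abs_of_nonneg (sub_nonneg.2 hzw)]
    exact tvDist_le_of_measureReal_sub_le fun A hA => measureReal_gaussianReal_sub_le hv hlt hA

theorem map_whiteNoise_restrict_add_mul {T : Type*} (Λ : Finset T) (z : T → ℝ) (c : ℝ) :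
    (whiteNoise T).map (fun η => Λ.restrict fun t => z t + c * η t) =
      Measure.pi fun t : Λ => gaussianReal (z t) (.mk (c ^ 2) (sq_nonneg c)) := by
  have hcomp : (fun η : T → ℝ => Λ.restrict fun t => z t + c * η t) =
      (fun (y : Λ → ℝ) (t : Λ) => z t + c * y t) ∘ Λ.restrict := rfl
  have hlaw : ∀ t : Λ, (gaussianReal 0 1).map (fun y => z t + c * y) =
      gaussianReal (z t) (.mk (c ^ 2) (sq_nonneg c)) := fun t => by
    rw [← Function.comp_def (z t + ·) (c * ·), ← Measure.map_map (by fun_prop) (by fun_prop),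
      gaussianReal_map_const_mul, gaussianReal_map_const_add, mul_zero, zero_add, mul_one]
  have : ∀ t : Λ, SigmaFinite ((gaussianReal 0 1).map fun y => z t + c * y) := fun t => by
    rw [hlaw]
    infer_instance
  rw [hcomp, ← Measure.map_map (by fun_prop) (by fun_prop), whiteNoise,
    Measure.infinitePi_map_restrict,
    Measure.pi_map_pi (f := fun (t : Λ) y => z t + c * y) fun t => by fun_prop]
  simp_rw [hlaw]

theorem tvDist_gaussianReal_half_le (z w : ℝ) :
    tvDist (gaussianReal z (.mk ((√2)⁻¹ ^ 2) (sq_nonneg _)))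
      (gaussianReal w (.mk ((√2)⁻¹ ^ 2) (sq_nonneg _))) ≤ |z - w| := by
  have hhalf : (√2 : ℝ)⁻¹ ^ 2 = 1 / 2 := by
    rw [inv_pow, Real.sq_sqrt zero_le_two, one_div]
  refine (tvDist_gaussianReal_le (NNReal.coe_ne_zero.1 ?_) z w).trans
    (mul_le_of_le_one_right (abs_nonneg _)
      (inv_le_one_of_one_le₀ (Real.one_le_sqrt.2 ?_)))
  · rw [NNReal.coe_mk, hhalf]
    norm_num
  · rw [NNReal.coe_mk, hhalf]
    linarith [Real.pi_gt_three]

theorem tvDist_map_whiteNoise_restrict_le {T : Type*} (Λ : Finset T) (z w : T → ℝ) :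
    tvDist ((whiteNoise T).map fun η => Λ.restrict fun t => z t + (√2)⁻¹ * η t)
        ((whiteNoise T).map fun η => Λ.restrict fun t => w t + (√2)⁻¹ * η t) ≤
      ∑ t : Λ, |z t - w t| := by
  rw [map_whiteNoise_restrict_add_mul, map_whiteNoise_restrict_add_mul]
  exact (tvDist_pi_le _ _).trans (Finset.sum_le_sum fun t _ => tvDist_gaussianReal_half_le _ _)

theorem tvDist_smoothedLaw_le {d : ℕ} {b b' : ℕ → ℝ} (hb : Summable fun n => |b n|)
    (hb' : Summable fun n => |b' n|) (Λ : Finset (Site d)) :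
    tvDist ((smoothedLaw d b).map Λ.restrict) ((smoothedLaw d b').map Λ.restrict) ≤
      Λ.card * ∑' n, |b n - b' n| := by
  have hsub : ∀ i, Integrable (fun ξ => |movingAverage b ξ i - movingAverage b' ξ i|)
      (whiteNoise (Site d)) := fun i =>
    ((integrable_movingAverage hb i).sub (integrable_movingAverage hb' i)).abs
  have hmeas : ∀ b : ℕ → ℝ, Measurable fun p : (Site d → ℝ) × (Site d → ℝ) =>
      Λ.restrict (smoothedField b p) := fun b =>
    (Finset.measurable_restrict Λ).comp measurable_smoothedField
  have hmap : ∀ b : ℕ → ℝ, (smoothedLaw d b).map Λ.restrict =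
      ((whiteNoise (Site d)).prod (whiteNoise (Site d))).map
        fun p => Λ.restrict (smoothedField b p) := fun b =>
    Measure.map_map (Finset.measurable_restrict Λ) measurable_smoothedField
  rw [hmap, hmap]
  calc tvDist _ _
      ≤ ∫ ξ, ∑ i : Λ, |movingAverage b ξ i - movingAverage b' ξ i| ∂(whiteNoise (Site d)) :=
        tvDist_map_prod_le (hmeas b) (hmeas b') (integrable_finsetSum _ fun i _ => hsub i)
          fun ξ => tvDist_map_whiteNoise_restrict_le Λ (movingAverage b ξ) (movingAverage b' ξ)
    _ = ∑ i : Λ, ∫ ξ, |movingAverage b ξ i - movingAverage b' ξ i| ∂(whiteNoise (Site d)) :=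
        integral_finsetSum _ fun i _ => hsub i
    _ ≤ ∑ _ : Λ, ∑' n, |b n - b' n| :=
        Finset.sum_le_sum fun i _ => integral_abs_movingAverage_sub_le hb hb' (i : Site d)
    _ = Λ.card * ∑' n, |b n - b' n| := by simp

end GaussianTotalVariation

section FiniteDependence

theorem IsDependent.mono {d : ℕ} {S : Type*} [MeasurableSpace S] {μ : Measure (Site d → S)}
    {k l : ℕ} (h : IsDependent k μ) (hkl : k ≤ l) : IsDependent l μ :=
  fun A B hAB => h A B fun a ha b hb => hkl.trans_lt (hAB a ha b hb)

theorem isDependent_zero_infinitePi {d : ℕ} {S : Type*} [MeasurableSpace S]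
    (μ : Site d → Measure S) [∀ i, IsProbabilityMeasure (μ i)] :
    IsDependent 0 (Measure.infinitePi μ) := by
  intro A B hAB
  refine IndepFun.process_indepFun_process (fun _ => measurable_pi_apply _)
    (fun _ => measurable_pi_apply _) fun I J => ?_
  have hdisj : Disjoint (I.map (.subtype _)) (J.map (.subtype _)) := by
    rw [Finset.disjoint_left]
    rintro i hi hi'
    obtain ⟨a, -, rfl⟩ := Finset.mem_map.1 hi
    obtain ⟨b, -, hb⟩ := Finset.mem_map.1 hi'
    have hlt := hAB a a.2 b b.2
    simp_all [l1Dist_self]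
  have hindep := (iIndepFun_infinitePi (P := μ) (X := fun _ x => x)
    fun _ => measurable_id).indepFun_finset _ _ hdisj fun _ => measurable_pi_apply _
  exact hindep.comp
    (φ := fun x (a : I) => x ⟨a.1, Finset.mem_map_of_mem (.subtype _) a.2⟩)
    (ψ := fun x (b : J) => x ⟨b.1, Finset.mem_map_of_mem (.subtype _) b.2⟩)
    (by fun_prop) (by fun_prop)

theorem pi_map_eval_of_subsingleton {ι S : Type*} [Fintype ι] [Subsingleton ι] [MeasurableSpace S]
    (μ : Measure (ι → S)) [IsProbabilityMeasure μ] :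
    Measure.pi (fun i => μ.map fun x => x i) = μ := by
  have : ∀ i, IsProbabilityMeasure (μ.map fun x => x i) := fun i =>
    Measure.isProbabilityMeasure_map (measurable_pi_apply i).aemeasurable
  refine Measure.pi_eq fun s hs => ?_
  rcases isEmpty_or_nonempty ι with hι | ⟨⟨i⟩⟩
  · have huniv : Set.univ.pi s = Set.univ := Set.eq_univ_of_forall fun _ i => isEmptyElim i
    rw [huniv, measure_univ, Fintype.prod_empty]
  · have : Unique ι := uniqueOfSubsingleton i
    rw [Fintype.prod_unique, Measure.map_apply (measurable_pi_apply _) (hs _)]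
    congr 1
    ext x
    simp [Unique.forall_iff]

-- The marginals at a single site agree, so the trivial bound `1` is needed only for `2 ≤ |Λ|`.
theorem tvDist_infinitePi_map_eval_le {T S : Type*} [MeasurableSpace S] (μ : Measure (T → S))
    [IsProbabilityMeasure μ] (Λ : Finset T) :
    tvDist (μ.map Λ.restrict) ((Measure.infinitePi fun t => μ.map fun x => x t).map Λ.restrict) ≤
      Λ.card * (1 / 2) := by
  have : ∀ t, IsProbabilityMeasure (μ.map fun x => x t) := fun t =>
    Measure.isProbabilityMeasure_map (measurable_pi_apply t).aemeasurable
  have := Measure.isProbabilityMeasure_map (μ := μ) (Finset.measurable_restrict Λ).aemeasurable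
  rw [Measure.infinitePi_map_restrict]
  rcases le_or_gt Λ.card 1 with hcard | hcard
  · have : Subsingleton Λ := Finset.card_le_one_iff_subsingleton_coe.1 hcard
    have hmarginal : ∀ t : Λ, (μ.map Λ.restrict).map (fun x => x t) = μ.map fun x => x t :=
      fun t => Measure.map_map (measurable_pi_apply t) (Finset.measurable_restrict Λ)
    have hpi := pi_map_eval_of_subsingleton (μ.map Λ.restrict)
    simp_rw [hmarginal] at hpi
    rw [hpi, tvDist_self]
    positivity
  · refine (tvDist_le_one _ _).trans ?_
    have : (2 : ℝ) ≤ Λ.card := by exact_mod_cast hcard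
    linarith

end FiniteDependence

section Truncation

theorem tsum_abs_sub_indicator_Iic_le {b : ℕ → ℝ} {R : ℝ} (hR : 1 ≤ R)
    (hb : Summable fun n => |b n| * R ^ n) (N : ℕ) :
    ∑' n, |b n - (Set.Iic N).indicator b n| ≤ (∑' n, |b n| * R ^ n) * R⁻¹ ^ (N + 1) := by
  have : 0 < R := one_pos.trans_le hR
  have hle : ∀ n, |b n - (Set.Iic N).indicator b n| ≤ |b n| * R ^ n * R⁻¹ ^ (N + 1) := fun n => by
    rcases le_or_gt n N with hn | hn
    · rw [Set.indicator_of_mem (Set.mem_Iic.2 hn), sub_self, abs_zero]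
      positivity
    · rw [Set.indicator_of_notMem (by simpa using hn), sub_zero, mul_assoc, inv_pow,
        ← div_eq_mul_inv]
      exact le_mul_of_one_le_right (abs_nonneg _)
        ((one_le_div (by positivity)).2 (pow_le_pow_right₀ hR hn))
  rw [← tsum_mul_right]
  exact (Summable.of_nonneg_of_le (fun _ => abs_nonneg _) hle (hb.mul_right _)).tsum_le_tsum hle
    (hb.mul_right _)

theorem exists_isDependent_tvDist_smoothedLaw_le (d : ℕ) {b : ℕ → ℝ} {a : ℝ} (ha : 0 ≤ a)
    (hb : Summable fun n => |b n| * Real.exp (2 * a) ^ n) (l : ℕ) :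
    ∃ ν : Measure (Site d → ℝ), IsProbabilityMeasure ν ∧ IsDependent l ν ∧
      ∀ Λ : Finset (Site d), tvDist ((smoothedLaw d b).map Λ.restrict) (ν.map Λ.restrict) ≤
        Λ.card * ((∑' n, |b n| * Real.exp (2 * a) ^ n) * Real.exp (-a * l)) := by
  have hR : 1 ≤ Real.exp (2 * a) := Real.one_le_exp (by positivity)
  have hb1 : Summable fun n => |b n| := hb.of_nonneg_of_le (fun _ => abs_nonneg _)
    fun n => le_mul_of_one_le_right (abs_nonneg _) (one_le_pow₀ hR)
  have hb' : Summable fun n => |(Set.Iic (l / 2)).indicator b n| :=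
    (hb1.of_abs.indicator _).abs
  have hexp : (Real.exp (2 * a))⁻¹ ^ (l / 2 + 1) ≤ Real.exp (-a * l) := by
    have hl : (l : ℝ) ≤ 2 * ((l / 2 : ℕ) + 1) := by exact_mod_cast (by lia : l ≤ 2 * (l / 2 + 1))
    rw [← Real.exp_neg, ← Real.exp_nat_mul, Real.exp_le_exp, Nat.cast_add_one]
    nlinarith
  refine ⟨smoothedLaw d ((Set.Iic (l / 2)).indicator b), inferInstance, ?_, fun Λ => ?_⟩
  · refine (isDependent_smoothedLaw hb' fun n hn => ?_).mono (Nat.mul_div_le l 2)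
    exact Set.indicator_of_notMem (by simpa using hn) b
  · refine (tvDist_smoothedLaw_le hb1 hb' Λ).trans
      (mul_le_mul_of_nonneg_left ((tsum_abs_sub_indicator_Iic_le hR hb _).trans ?_) (by positivity))
    exact mul_le_mul_of_nonneg_left hexp (tsum_nonneg fun n => by positivity)

theorem exists_pos_forall_le_exp_or_half_le_exp (C : ℝ) {a : ℝ} (ha : 0 < a) :
    ∃ c : ℝ, 0 < c ∧ ∀ l : ℕ,
      C * Real.exp (-a * l) ≤ Real.exp (-c * l) ∨ 1 / 2 ≤ Real.exp (-c * l) := by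
  have htend : Tendsto (fun l : ℕ => C * Real.exp (-(a / 2) * l)) atTop (𝓝 (C * 0)) :=
    (Real.tendsto_exp_atBot.comp
      (tendsto_natCast_atTop_atTop.const_mul_atTop_of_neg (by linarith))).const_mul C
  rw [mul_zero] at htend
  obtain ⟨M, hM⟩ := eventually_atTop.1 (htend.eventually_le_const one_pos)
  refine ⟨min (a / 2) (1 / (2 * (M + 1))), by positivity, fun l => ?_⟩
  set c := min (a / 2) (1 / (2 * ((M : ℝ) + 1)))
  rcases le_total M l with hl | hl
  · left
    calc C * Real.exp (-a * l) = C * Real.exp (-(a / 2) * l) * Real.exp (-(a / 2) * l) := by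
          rw [mul_assoc, ← Real.exp_add]
          ring_nf
      _ ≤ Real.exp (-(a / 2) * l) :=
          mul_le_of_le_one_left (Real.exp_nonneg _) (hM l hl)
      _ ≤ Real.exp (-c * l) := by
          gcongr
          exact min_le_left _ _
  · right
    have hcl : c * l ≤ 1 / 2 := calc
      c * l ≤ 1 / (2 * ((M : ℝ) + 1)) * (M + 1) := by
          gcongr
          · exact min_le_right _ _
          · exact_mod_cast hl.trans M.le_succ
      _ = 1 / 2 := by field_simp
    linarith [Real.add_one_le_exp (-c * l)]

theorem exists_pos_forall_isDependent_tvDist_smoothedLaw_le (d : ℕ) {b : ℕ → ℝ} {a : ℝ}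
    (ha : 0 < a) (hb : Summable fun n => |b n| * Real.exp (2 * a) ^ n) :
    ∃ c : ℝ, 0 < c ∧ ∀ l : ℕ, ∃ ν : Measure (Site d → ℝ), IsProbabilityMeasure ν ∧
      IsDependent l ν ∧ ∀ Λ : Finset (Site d),
        tvDist ((smoothedLaw d b).map Λ.restrict) (ν.map Λ.restrict) ≤
          Λ.card * Real.exp (-c * l) := by
  obtain ⟨c, hc, hrate⟩ :=
    exists_pos_forall_le_exp_or_half_le_exp (∑' n, |b n| * Real.exp (2 * a) ^ n) ha
  refine ⟨c, hc, fun l => ?_⟩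
  rcases hrate l with h | h
  · obtain ⟨ν, hν, hdep, htv⟩ := exists_isDependent_tvDist_smoothedLaw_le d ha.le hb l
    exact ⟨ν, hν, hdep, fun Λ => (htv Λ).trans (mul_le_mul_of_nonneg_left h (by positivity))⟩
  · have : ∀ i, IsProbabilityMeasure ((smoothedLaw d b).map fun x => x i) := fun i =>
      Measure.isProbabilityMeasure_map (measurable_pi_apply i).aemeasurable
    exact ⟨_, inferInstance, (isDependent_zero_infinitePi _).mono l.zero_le, fun Λ =>
      (tvDist_infinitePi_map_eval_le _ Λ).trans (mul_le_mul_of_nonneg_left h (by positivity))⟩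

theorem exists_pos_mul_exp_two_mul_lt_one {x : ℝ} (hx : x < 1) :
    ∃ a : ℝ, 0 < a ∧ x * Real.exp (2 * a) < 1 := by
  have hcont : ContinuousAt (fun a => x * Real.exp (2 * a)) 0 := by fun_prop
  have hlt : ∀ᶠ a in 𝓝[>] (0 : ℝ), x * Real.exp (2 * a) < 1 :=
    (hcont.eventually_lt_const (by simpa)).filter_mono nhdsWithin_le_nhds
  obtain ⟨a, ha, ha0⟩ := (hlt.and self_mem_nhdsWithin).exists
  exact ⟨a, ha0, ha⟩

end Truncation

end GaussFactor

theorem theorem1_general (d : ℕ) (_hd : 1 ≤ d) (ε : ℝ) (hε : |ε| < 1) :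
    (∃! μ : Measure (GaussFactor.Site d → ℝ), GaussFactor.IsGaussianMarkovField d ε μ) ∧
    ∀ μ : Measure (GaussFactor.Site d → ℝ), GaussFactor.IsGaussianMarkovField d ε μ →
      GaussFactor.IsFactorOfIID μ ∧
      ∃ c : ℝ, 0 < c ∧ ∀ l : ℕ, ∃ ν : Measure (GaussFactor.Site d → ℝ),
        IsProbabilityMeasure ν ∧ GaussFactor.IsDependent l ν ∧
        ∀ Λ : Finset (GaussFactor.Site d),
          GaussFactor.tvDist (μ.map Λ.restrict) (ν.map Λ.restrict) ≤
            (Λ.card : ℝ) * Real.exp (-c * l) := by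
  obtain ⟨a, ha, hεa⟩ := GaussFactor.exists_pos_mul_exp_two_mul_lt_one hε
  refine ⟨⟨_, GaussFactor.isGaussianMarkovField_smoothedLaw hε,
    fun μ hμ => hμ.eq_smoothedLaw hε⟩, fun μ hμ => ?_⟩
  obtain rfl := hμ.eq_smoothedLaw hε
  exact ⟨GaussFactor.isFactorOfIID_smoothedLaw,
    GaussFactor.exists_pos_forall_isDependent_tvDist_smoothedLaw_le d ha
      (GaussFactor.summable_abs_sqrtCoeff_mul_pow (Real.exp_nonneg _) hεa)⟩

theorem theorem1 (d : ℕ) (hd : 1 ≤ d) :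
    ∃ ε₀ : ℝ, 0 < ε₀ ∧ ∀ ε : ℝ, |ε| < ε₀ →
      (∃! μ : Measure (GaussFactor.Site d → ℝ), GaussFactor.IsGaussianMarkovField d ε μ) ∧
      ∀ μ : Measure (GaussFactor.Site d → ℝ), GaussFactor.IsGaussianMarkovField d ε μ →
        GaussFactor.IsFactorOfIID μ ∧
        ∃ c : ℝ, 0 < c ∧ ∀ l : ℕ, ∃ ν : Measure (GaussFactor.Site d → ℝ),
          IsProbabilityMeasure ν ∧ GaussFactor.IsDependent l ν ∧
          ∀ Λ : Finset (GaussFactor.Site d),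
            GaussFactor.tvDist (μ.map Λ.restrict) (ν.map Λ.restrict)
              ≤ (Λ.card : ℝ) * Real.exp (-c * l) :=
  ⟨1, one_pos, fun ε hε => theorem1_general d hd ε hε⟩
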